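/- Let $X$ be a separable real Banach space and let $\gamma$ be a nondegenerate centred Gaussian measure on $X$, with covariance operator $Q:X^*\to X$, $Q\ell=\int_X \ell(x)\,x\,d\gamma(x)$. Let $H$ be the Cameron–Martin space of $\gamma$, i.e. the image of $\mathcal H:=\overline{X^*}^{L^2(\gamma)}$ under the injective map $\hat h\mapsto h=\int_X\hat h(x)\,x\,d\gamma(x)$, with the norm $|h|_H=\|\hat h\|_{L^2(\gamma)}$ and the corresponding inner product $[\cdot,\cdot]_H$. For $\ell\in X^*$ and $h=Q\ell$ we have $\hat h=\ell$. Let $s\in(0,1)$ and $\mathbb R^+=(0,\infty)$. *Sobolev space.* $H^1(X\times\mathbb R^+,\gamma\otimes y^{1-2s}dy)$ is the set of the functions $v:X\times\mathbb R^+\to\mathbb R$ that have weak derivatives $\partial_y v$ and $\nabla_\gamma v$ (the latter $H$-valued), with $$\int_{X\times\mathbb R^+}\bigl(|v|^2+|\nabla_\gamma v|_H^2+|\partial_y v|^2\bigr)\,y^{1-2s}\,d\gamma\,dy<\infty .$$ Here $v$ and its weak derivatives are square integrable for $\gamma\otimes dy$ on $X\times[a,b]$ for all $0<a\le b<\infty$,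 and they satisfy $$\int v\,\varphi\,\eta'\,d\gamma\,dy=-\int \partial_yv\,\varphi\,\eta\,d\gamma\,dy,\qquad \int v\,(\partial_k\varphi-\hat k\,\varphi)\,\eta\,d\gamma\,dy=-\int[\nabla_\gamma v,k]_H\,\varphi\,\eta\,d\gamma\,dy$$ for all $k\in Q(X^*)$, all cylindrical functions $\varphi(x)=f(\ell_1(x),\dots,\ell_m(x))$ with $\ell_i\in X^*$ and $f\in C^1_b(\mathbb R^m)$, and all $\eta\in C_c^\infty(\mathbb R^+)$. *Symmetrisation.* Let $\gamma_1$ be the standard Gaussian measure on $\mathbb R$ and $\Phi(t)=\gamma_1((-\infty,t])$. For $I\subset\mathbb R$ put $I^*=(-\infty,\Phi^{-1}(\gamma_1(I)))$, with $\Phi^{-1}(0)=-\infty$ and $\Phi^{-1}(1)=+\infty$. Let $h=Q\ell$ with $\ell\in X^*$ and $|h|_H=1$, and write $x=x'+th$ with $t=\hat h(x)=\ell(x)$. For $v:X\times\mathbb R^+\to\mathbb R$, the Ehrhard symmetrisation of $v$ in the direction $h$, at each fixed $y$, is $$v_h^*(x'+th,\,y)=\sup\bigl\{c\in\mathbb R:\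 t\in\{\tau\in\mathbb R:\ v(x'+\tau h,y)>c\}^*\bigr\}.$$ **Lemma.** Let $v\in H^1(X\times\mathbb R^+,\gamma\otimes y^{1-2s}dy)$, let $h=Q\ell$ with $\ell\in X^*$ and $|h|_H=1$, and set $$J_1(v)=\int_{X\times\mathbb R^+}|\partial_yv|^2\,y^{1-2s}\,d\gamma(x)\,dy .$$ Then $v_h^*$ has a weak derivative $\partial_y v_h^*$ on $X\times\mathbb R^+$, and $J_1(v_h^*)\le J_1(v)$. -/

import Mathlib

noncomputable section

namespace Wiener

open MeasureTheory ProbabilityTheory Set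
open scoped ENNReal

/-- The covariance operator `Q : X* → X` of a centred measure `γ`, `Q ℓ = ∫ ℓ(x) x dγ(x)`
(Bochner integral).  For `h = Q ℓ` one has `ĥ = ℓ`, as functions in `L²(γ)`. -/
def covOp {X : Type*} [NormedAddCommGroup X] [NormedSpace ℝ X] [MeasurableSpace X]
    (γ : Measure X) (ℓ : StrongDual ℝ X) : X :=
  ∫ x, ℓ x • x ∂γ

/-- The closure of `X*` in `L²(γ)`.  The map `ĥ ↦ R ĥ = ∫ ĥ(x) x dγ(x)` is an isometry of this
Hilbert space onto the Cameron-Martin space `H`, by the very definition of the inner product of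
`H`; so elements `h` of `H` are represented here by the corresponding `ĥ`. -/
def cameronMartin {X : Type*} [NormedAddCommGroup X] [NormedSpace ℝ X] [MeasurableSpace X]
    [BorelSpace X] (γ : Measure X) : Submodule ℝ (Lp ℝ 2 γ) :=
  (LinearMap.range (StrongDual.toLp (𝕜 := ℝ) γ 2).toLinearMap).topologicalClosure

/-- The element of the Cameron-Martin space given by `ℓ ∈ X*`, that is, `h = Q ℓ` in the
representation by `ĥ`, which is the class of `ℓ` in `L²(γ)`. -/
def ofDual {X : Type*} [NormedAddCommGroup X] [NormedSpace ℝ X] [MeasurableSpace X]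
    [BorelSpace X] (γ : Measure X) (ℓ : StrongDual ℝ X) : cameronMartin γ :=
  ⟨StrongDual.toLp γ 2 ℓ, Submodule.le_topologicalClosure _ ⟨ℓ, rfl⟩⟩

/-- Cylindrical functions of class `C¹_b`. -/
def IsCylindrical {X : Type*} [NormedAddCommGroup X] [NormedSpace ℝ X] (φ : X → ℝ) : Prop :=
  ∃ (m : ℕ) (ℓ : Fin m → StrongDual ℝ X) (f : (Fin m → ℝ) → ℝ),
    ContDiff ℝ 1 f ∧ (∃ C : ℝ, ∀ z, |f z| ≤ C ∧ ‖fderiv ℝ f z‖ ≤ C) ∧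
      φ = fun x => f fun i => ℓ i x

/-- Test functions of class `C_c^∞` on the open half-line `(0, ∞)`. -/
def IsTest (η : ℝ → ℝ) : Prop :=
  ContDiff ℝ (⊤ : ℕ∞) η ∧ HasCompactSupport η ∧ tsupport η ⊆ Ioi 0

/-- `L²_loc(X × (0, ∞))` with respect to `γ ⊗ dy`: square integrable on `X × [a, b]` for all
compact intervals `[a, b]` in `(0, ∞)`.  Functions on `X × (0, ∞)` are written as functions on
`X × ℝ`, whose values at points `(x, y)` with `y ≤ 0` play no role. -/
def IsLocL2 {X : Type*} [MeasurableSpace X] {F : Type*} [NormedAddCommGroup F]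
    (γ : Measure X) (f : X × ℝ → F) : Prop :=
  ∀ a b : ℝ, 0 < a → MemLp f 2 ((γ.prod volume).restrict (univ ×ˢ Icc a b))

/-- `w = ∂_y v` in the weak sense on `X × (0, ∞)`. -/
structure HasWeakDy {X : Type*} [NormedAddCommGroup X] [NormedSpace ℝ X] [MeasurableSpace X]
    (γ : Measure X) (v w : X × ℝ → ℝ) : Prop where
  locL2 : IsLocL2 γ v
  locL2_deriv : IsLocL2 γ w
  integral_eq : ∀ (φ : X → ℝ) (η : ℝ → ℝ), IsCylindrical φ → IsTest η →
    ∫ p, v p * (φ p.1 * deriv η p.2) ∂(γ.prod volume) =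
      -∫ p, w p * (φ p.1 * η p.2) ∂(γ.prod volume)

/-- `G = ∇_γ v` in the weak sense on `X × (0, ∞)`: for every `h = Q ℓ`,
`∫ v (∂_h φ - ĥ φ) η dγ dy = - ∫ [G, h]_H φ η dγ dy`. -/
structure HasWeakGrad {X : Type*} [NormedAddCommGroup X] [NormedSpace ℝ X] [MeasurableSpace X]
    [BorelSpace X] (γ : Measure X) (v : X × ℝ → ℝ) (G : X × ℝ → cameronMartin γ) : Prop where
  locL2 : IsLocL2 γ v
  locL2_grad : IsLocL2 γ G
  integral_eq : ∀ (ℓ : StrongDual ℝ X) (φ : X → ℝ) (η : ℝ → ℝ), IsCylindrical φ → IsTest η →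
    ∫ p, v p * ((fderiv ℝ φ p.1 (covOp γ ℓ) - ℓ p.1 * φ p.1) * η p.2) ∂(γ.prod volume) =
      -∫ p, inner ℝ (G p) (ofDual γ ℓ) * (φ p.1 * η p.2) ∂(γ.prod volume)

/-- The measure `γ ⊗ y^{1-2s} dy` on `X × (0, ∞)`. -/
def extMeasure {X : Type*} [MeasurableSpace X] (γ : Measure X) (s : ℝ) : Measure (X × ℝ) :=
  γ.prod ((volume.restrict (Ioi 0)).withDensity fun y : ℝ => ENNReal.ofReal (y ^ (1 - 2 * s)))

/-- The space `H¹(X × ℝ⁺, γ ⊗ y^{1-2s} dy)`. -/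
def MemH1 {X : Type*} [NormedAddCommGroup X] [NormedSpace ℝ X] [MeasurableSpace X]
    [BorelSpace X] (γ : Measure X) (s : ℝ) (v : X × ℝ → ℝ) : Prop :=
  ∃ (w : X × ℝ → ℝ) (G : X × ℝ → cameronMartin γ), HasWeakDy γ v w ∧ HasWeakGrad γ v G ∧
    ∫⁻ p, (‖v p‖ₑ ^ 2 + ‖G p‖ₑ ^ 2 + ‖w p‖ₑ ^ 2) ∂(extMeasure γ s) < ⊤

/-- The half-line `I* = (-∞, Φ⁻¹(γ₁(I)))`, where `γ₁` is the standard Gaussian measure on `ℝ` and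
`Φ(t) = γ₁((-∞, t])`, with `Φ⁻¹(0) = -∞` and `Φ⁻¹(1) = +∞`. -/
def starSet (I : Set ℝ) : Set ℝ :=
  {t | gaussianReal 0 1 (Iic t) < gaussianReal 0 1 I}

/-- The Ehrhard symmetrisation `u*_h` of `u : X → ℝ` in the direction `h = Q ℓ`, `|h|_H = 1`:
writing `x = x' + t h` with `t = ĥ(x) = ℓ x`, it is `sup {c | t ∈ {τ | u (x' + τ h) > c}*}`. -/
def ehrhard {X : Type*} [NormedAddCommGroup X] [NormedSpace ℝ X] [MeasurableSpace X]
    (γ : Measure X) (ℓ : StrongDual ℝ X) (u : X → ℝ) (x : X) : ℝ :=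
  sSup {c : ℝ | ℓ x ∈ starSet {τ : ℝ | c < u ((x - ℓ x • covOp γ ℓ) + τ • covOp γ ℓ)}}

/-- The symmetrisation of a function on `X × (0, ∞)`, at each fixed height `y`. -/
def ehrhardExt {X : Type*} [NormedAddCommGroup X] [NormedSpace ℝ X] [MeasurableSpace X]
    (γ : Measure X) (ℓ : StrongDual ℝ X) (v : X × ℝ → ℝ) (p : X × ℝ) : ℝ :=
  ehrhard γ ℓ (fun x => v (x, p.2)) p.1

/-- `∫ |w|² y^{1-2s} dγ dy` over `X × (0, ∞)`, as a value in `[0, ∞]`; with `w = ∂_y v` this is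
the vertical energy `J₁(v)`. -/
def energy {X : Type*} [MeasurableSpace X] (γ : Measure X) (s : ℝ) (w : X × ℝ → ℝ) : ℝ≥0∞ :=
  ∫⁻ p, ‖w p‖ₑ ^ 2 ∂(extMeasure γ s)

end Wiener

end

noncomputable section

namespace Wiener

open MeasureTheory ProbabilityTheory Set Filter Topology
open scoped ENNReal

/-! Along each line in the direction `h`, Ehrhard symmetrisation is the decreasing rearrangement
with respect to `γ₁`, and rearrangement is nonexpansive in `L²(γ₁)` (`lintegral_rearr_sub_sq_le`).
Since `x'` and `ℓ x` are independent under `γ`, the map `shear` sends `γ ⊗ γ₁` to `γ`, and Fubini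
makes symmetrisation nonexpansive in `L²(γ)` (`lintegral_ehrhard_sub_sq_le`).

This is applied to the two slices `v(·, y + ε)` and `v(·, y)`: the vertical increments of `v*` are
no larger in `L²(γ)` than those of `v`. The latter are integrals of `∂_y v`, so by Cauchy-Schwarz
they are at most `ε ∫₀^ε ‖∂_y v(·, y + θ)‖² dθ` in square (`HasWeakDy.ae_lintegral_sub_sq_le`).

Hence the difference quotients of `v*` are bounded in the weighted `L²` space, with a bound tending
to `J₁(v)` (`energy_diffQuot_le`). A weak limit point of them is a weak derivative of `v*`, by
discrete integration by parts, and it inherits the bound on the norm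
(`exists_hasWeakDy_of_sub_sq_le`). -/

/-! ### Gaussian rearrangement on the line and its contraction property in `L²`. -/

/-- The decreasing rearrangement of `f : ℝ → ℝ` with respect to the standard Gaussian measure. -/
def rearr (f : ℝ → ℝ) (t : ℝ) : ℝ := sSup {c : ℝ | t ∈ starSet {τ : ℝ | c < f τ}}

theorem gaussian_Iic_pos (t : ℝ) : 0 < gaussianReal 0 1 (Iic t) := by
  rw [pos_iff_ne_zero]
  intro h
  have := gaussianReal_absolutelyContinuous' 0 (v := 1) one_ne_zero h
  simp at this

theorem gaussian_Iic_lt_one (t : ℝ) : gaussianReal 0 1 (Iic t) < 1 := by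
  rw [← compl_Ioi, prob_compl_eq_one_sub measurableSet_Ioi]
  refine ENNReal.sub_lt_self ENNReal.one_ne_top one_ne_zero ?_
  intro h
  have := gaussianReal_absolutelyContinuous' 0 (v := 1) one_ne_zero h
  simp at this

theorem measurable_gaussian_Iic : Measurable fun t : ℝ => gaussianReal 0 1 (Iic t) := by
  have : Monotone fun t : ℝ => gaussianReal 0 1 (Iic t) :=
    fun a b h => measure_mono (Iic_subset_Iic.2 h)
  exact this.measurable

theorem gaussian_superlevel_anti (f : ℝ → ℝ) :
    Antitone fun c : ℝ => gaussianReal 0 1 {τ | c < f τ} :=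
  fun _ _ h => measure_mono fun _ hτ => lt_of_le_of_lt h hτ

/-- Right continuity of the distribution function: the sets `{f > c}` increase to `{f > b}` as `c`
decreases to `b`. -/
theorem exists_lt_gaussian_superlevel (f : ℝ → ℝ) {b : ℝ} {α : ℝ≥0∞}
    (h : α < gaussianReal 0 1 {τ | b < f τ}) :
    ∃ c, b < c ∧ α < gaussianReal 0 1 {τ | c < f τ} := by
  obtain ⟨u, hu, hub, hlim⟩ := exists_seq_strictAnti_tendsto b
  have heq : {τ | b < f τ} = ⋃ n, {τ | u n < f τ} := by
    ext τ
    simp only [mem_ofPred_eq, mem_iUnion]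
    exact ⟨fun hb => (hlim.eventually_lt_const hb).exists, fun ⟨n, hn⟩ => (hub n).trans hn⟩
  have hm : Monotone fun n => {τ | u n < f τ} :=
    fun i j hij τ hτ => lt_of_le_of_lt (hu.antitone hij) hτ
  rw [heq, hm.measure_iUnion, lt_iSup_iff] at h
  obtain ⟨n, hn⟩ := h
  exact ⟨u n, hub n, hn⟩

theorem exists_lt_gaussian_superlevel_of_lt_one (f : ℝ → ℝ) {α : ℝ≥0∞} (h : α < 1) :
    ∃ c : ℝ, α < gaussianReal 0 1 {τ | c < f τ} := by
  have heq : (univ : Set ℝ) = ⋃ n : ℕ, {τ | -(n : ℝ) < f τ} := by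
    ext τ
    simp only [mem_univ, mem_iUnion, mem_ofPred_eq, true_iff]
    obtain ⟨n, hn⟩ := exists_nat_gt (-f τ)
    exact ⟨n, by linarith⟩
  have hm : Monotone fun n : ℕ => {τ | -(n : ℝ) < f τ} := by
    intro i j hij τ hτ
    have : (i : ℝ) ≤ j := by exact_mod_cast hij
    simp only [mem_ofPred_eq] at hτ ⊢
    linarith
  rw [← measure_univ (μ := gaussianReal 0 1), heq, hm.measure_iUnion, lt_iSup_iff] at h
  obtain ⟨n, hn⟩ := h
  exact ⟨_, hn⟩

theorem exists_gaussian_superlevel_lt {f : ℝ → ℝ} (hf : Measurable f) {α : ℝ≥0∞} (h : 0 < α) :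
    ∃ c : ℝ, gaussianReal 0 1 {τ | c < f τ} < α := by
  have hm : Antitone fun n : ℕ => {τ | (n : ℝ) < f τ} := by
    intro i j hij τ hτ
    have : (i : ℝ) ≤ j := by exact_mod_cast hij
    simp only [mem_ofPred_eq] at hτ ⊢
    linarith
  have ht := tendsto_measure_iInter_atTop (μ := gaussianReal 0 1)
    (s := fun n : ℕ => {τ | (n : ℝ) < f τ})
    (fun n => (measurableSet_lt measurable_const hf).nullMeasurableSet) hm ⟨0, measure_ne_top _ _⟩
  have hempty : (⋂ n : ℕ, {τ | (n : ℝ) < f τ}) = ∅ := by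
    ext τ
    simp only [mem_iInter, mem_ofPred_eq, mem_empty_iff_false, iff_false, not_forall, not_lt]
    exact exists_nat_ge (f τ)
  rw [hempty, measure_empty] at ht
  obtain ⟨n, hn⟩ := (ht.eventually_lt_const h).exists
  exact ⟨_, hn⟩

/-- All later facts on `rearr` come from this description of its superlevel sets. As `0 < γ₁(Iic t)
< 1`, the set under the supremum is nonempty and bounded above, so the default value of `sSup` never
enters. Strictness on the left comes from right continuity of the distribution function. -/
theorem lt_rearr_iff {f : ℝ → ℝ} (hf : Measurable f) (b t : ℝ) :
    b < rearr f t ↔ gaussianReal 0 1 (Iic t) < gaussianReal 0 1 {τ | b < f τ} := by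
  constructor
  · intro h
    obtain ⟨c, hc, hbc⟩ := exists_lt_of_lt_csSup
      (exists_lt_gaussian_superlevel_of_lt_one f (gaussian_Iic_lt_one t)) h
    exact lt_of_lt_of_le hc (gaussian_superlevel_anti f hbc.le)
  · intro h
    obtain ⟨c, hbc, hc⟩ := exists_lt_gaussian_superlevel f h
    refine hbc.trans_le (le_csSup ?_ hc)
    obtain ⟨d, hd⟩ := exists_gaussian_superlevel_lt hf (gaussian_Iic_pos t)
    refine ⟨d, fun e he => ?_⟩
    by_contra hlt
    exact absurd (lt_of_lt_of_le he (gaussian_superlevel_anti f (not_le.1 hlt).le)) (not_lt.2 hd.le)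

theorem rearr_congr {f g : ℝ → ℝ} (h : f =ᵐ[gaussianReal 0 1] g) : rearr f = rearr g := by
  ext t
  unfold rearr starSet
  congr 1
  ext c
  have : gaussianReal 0 1 {τ | c < f τ} = gaussianReal 0 1 {τ | c < g τ} := by
    refine measure_congr ?_
    filter_upwards [h] with τ hτ
    change (c < f τ) = (c < g τ)
    rw [hτ]
  simp only [mem_ofPred_eq, this]

theorem rearr_zero (t : ℝ) : rearr (fun _ => 0) t = 0 := by
  refine le_antisymm (not_lt.1 fun h => ?_) (le_of_forall_lt fun b hb => ?_)
  · rw [lt_rearr_iff measurable_const] at h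
    simp at h
  · rw [lt_rearr_iff measurable_const]
    simpa [hb] using gaussian_Iic_lt_one t

/-- Inner regularity replaces the computation with `Φ⁻¹`: a compact subset has a greatest element
`t`, hence lies in `Iic t`, whose mass is below `β`. -/
theorem measure_gaussian_Iic_lt_le (β : ℝ≥0∞) :
    gaussianReal 0 1 {t : ℝ | gaussianReal 0 1 (Iic t) < β} ≤ β := by
  rw [(measurableSet_lt measurable_gaussian_Iic measurable_const).measure_eq_iSup_isCompact]
  refine iSup₂_le fun K hK => iSup_le fun hc => ?_
  rcases K.eq_empty_or_nonempty with rfl | hne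
  · simp
  · obtain ⟨t, ht, hmax⟩ := hc.exists_isGreatest hne
    exact (measure_mono fun x hx => hmax hx).trans (hK ht).le

theorem measure_le_gaussian_Iic_le (α : ℝ≥0∞) :
    gaussianReal 0 1 {t : ℝ | α ≤ gaussianReal 0 1 (Iic t)} ≤ 1 - α := by
  rw [(measurableSet_le measurable_const measurable_gaussian_Iic).measure_eq_iSup_isCompact]
  refine iSup₂_le fun K hK => iSup_le fun hc => ?_
  rcases K.eq_empty_or_nonempty with rfl | hne
  · simp
  · obtain ⟨t, ht, hmin⟩ := hc.exists_isLeast hne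
    have : NullSingletonClass (gaussianReal 0 1) :=
      nullSingletonClass_gaussianReal one_ne_zero
    calc gaussianReal 0 1 K ≤ gaussianReal 0 1 (Ici t) := measure_mono fun x hx => hmin hx
      _ = 1 - gaussianReal 0 1 (Iio t) := by
        rw [← compl_Iio, prob_compl_eq_one_sub measurableSet_Iio]
      _ = 1 - gaussianReal 0 1 (Iic t) := by rw [measure_congr Iio_ae_eq_Iic]
      _ ≤ 1 - α := tsub_le_tsub_left (hK ht) _

theorem measurable_rearr {f : ℝ → ℝ} (hf : Measurable f) : Measurable (rearr f) := by
  refine measurable_of_Ioi fun b => ?_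
  have : rearr f ⁻¹' Ioi b = {t | gaussianReal 0 1 (Iic t) < gaussianReal 0 1 {τ | b < f τ}} := by
    ext t; exact lt_rearr_iff hf b t
  rw [this]
  exact measurableSet_lt measurable_gaussian_Iic measurable_const

/-- The superlevel sets of rearrangements are nested half-lines, so the left side is at most `β -
α`, or zero if `β ≤ α`. For the original functions, `{f > b}` is covered by `{g > a}` and the set on
the right, which therefore has mass at least `β - α`. -/
theorem measure_rearr_le_lt_le {f g : ℝ → ℝ} (hf : Measurable f) (hg : Measurable g) (a b : ℝ) :
    gaussianReal 0 1 {t | rearr g t ≤ a ∧ b < rearr f t} ≤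
      gaussianReal 0 1 {t | g t ≤ a ∧ b < f t} := by
  set μ := gaussianReal 0 1
  set α := μ {t | a < g t} with hα
  set β := μ {t | b < f t} with hβ
  have h1 : {t | rearr g t ≤ a ∧ b < rearr f t} = {t | μ (Iic t) < β} \ {t | μ (Iic t) < α} := by
    ext t
    rw [Set.mem_sdiff, mem_ofPred_eq, lt_rearr_iff hf, ← not_lt, lt_rearr_iff hg]
    exact and_comm
  have hgen : β ≤ α + μ {t | g t ≤ a ∧ b < f t} := by
    refine (measure_mono ?_).trans (measure_union_le _ _)
    intro t ht
    by_cases h : a < g t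
    · exact Or.inl h
    · exact Or.inr ⟨not_lt.1 h, ht⟩
  rw [h1]
  rcases le_total β α with h | h
  · have h0 : {t | μ (Iic t) < β} \ {t | μ (Iic t) < α} = ∅ :=
      sdiff_eq_empty.2 fun t ht => lt_of_lt_of_le (show μ (Iic t) < β from ht) h
    rw [h0]
    simp
  · have hsub : {t | μ (Iic t) < α} ⊆ {t | μ (Iic t) < β} := fun t ht => lt_of_lt_of_le ht h
    rw [measure_sdiff hsub (measurableSet_lt measurable_gaussian_Iic
      measurable_const).nullMeasurableSet (measure_ne_top _ _)]
    have hge : α ≤ μ {t | μ (Iic t) < α} := by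
      have h2 := measure_le_gaussian_Iic_le α
      have h3 : {t | α ≤ μ (Iic t)} = {t | μ (Iic t) < α}ᶜ := by
        ext t; simp
      change μ {t | α ≤ μ (Iic t)} ≤ _ at h2
      rw [h3, prob_compl_eq_one_sub (measurableSet_lt measurable_gaussian_Iic measurable_const)] at h2
      exact (ENNReal.sub_le_sub_iff_left prob_le_one ENNReal.one_ne_top).1 h2
    calc _ ≤ β - α := tsub_le_tsub (measure_gaussian_Iic_lt_le β) hge
      _ ≤ _ := tsub_le_iff_left.2 hgen

theorem lintegral_Ici_volume_Ioo (x y : ℝ) :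
    ∫⁻ a in Ici y, volume (Ioo a x) = ENNReal.ofReal (max (x - y) 0 ^ 2 / 2) := by
  rcases le_total x y with h | h
  · rw [setLIntegral_congr_fun (g := fun _ => 0) measurableSet_Ici]
    · simp [max_eq_right (sub_nonpos.2 h)]
    · intro a ha
      simp [Ioo_eq_empty (not_lt.2 (h.trans ha))]
  · have h1 : ∫⁻ a in Ici y, volume (Ioo a x) = ∫⁻ a in Icc y x, ENNReal.ofReal (x - a) := by
      rw [← lintegral_indicator measurableSet_Ici, ← lintegral_indicator measurableSet_Icc]
      congr 1
      ext a
      by_cases ha : y ≤ a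
      · by_cases hx : a ≤ x
        · simp [indicator, ha, hx]
        · simp [indicator, ha, hx, (not_le.1 hx).le]
      · simp [indicator, ha]
    rw [h1, ← ofReal_integral_eq_lintegral_ofReal, max_eq_left (sub_nonneg.2 h)]
    · rw [integral_Icc_eq_integral_Ioc, ← intervalIntegral.integral_of_le h]
      congr 1
      rw [intervalIntegral.integral_comp_sub_left (fun a => a) x, integral_id]
      ring
    · exact (continuous_const.sub continuous_id).continuousOn.integrableOn_Icc
    · filter_upwards [ae_restrict_mem measurableSet_Icc] with a ha
      exact sub_nonneg.2 ha.2

/-- Layer-cake formula for the square: `(x - y)₊² / 2` is the area of the triangle `y ≤ a < b < x`.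
-/
theorem lintegral_triangle (x y : ℝ) :
    ∫⁻ a, ∫⁻ b, (if a < b ∧ y ≤ a ∧ b < x then 1 else 0 : ℝ≥0∞) =
      ENNReal.ofReal (max (x - y) 0 ^ 2 / 2) := by
  rw [← lintegral_Ici_volume_Ioo, ← lintegral_indicator measurableSet_Ici]
  congr 1
  ext a
  by_cases ha : y ≤ a
  · rw [indicator_of_mem (mem_Ici.2 ha), ← lintegral_indicator_one measurableSet_Ioo]
    congr 1
    ext b
    simp [indicator, ha]
  · simp [ha]

theorem enorm_sub_sq (x y : ℝ) :
    ‖x - y‖ₑ ^ 2 = 2 * ENNReal.ofReal (max (x - y) 0 ^ 2 / 2) +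
      2 * ENNReal.ofReal (max (y - x) 0 ^ 2 / 2) := by
  have h2 : (2 : ℝ≥0∞) = ENNReal.ofReal 2 := by simp
  rw [h2, ← ENNReal.ofReal_mul (by norm_num), ← ENNReal.ofReal_mul (by norm_num),
    ← ENNReal.ofReal_add (by positivity) (by positivity), Real.enorm_eq_ofReal_abs,
    ← ENNReal.ofReal_pow (abs_nonneg _)]
  congr 1
  rw [sq_abs]
  rcases le_total x y with h | h
  · rw [max_eq_right (sub_nonpos.2 h), max_eq_left (sub_nonneg.2 h)]; ring
  · rw [max_eq_right (sub_nonpos.2 h), max_eq_left (sub_nonneg.2 h)]; ring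

theorem lintegral_posPart_sq {f g : ℝ → ℝ} (hf : Measurable f) (hg : Measurable g) :
    ∫⁻ t, ENNReal.ofReal (max (f t - g t) 0 ^ 2 / 2) ∂(gaussianReal 0 1) =
      ∫⁻ a, ∫⁻ b, (if a < b then gaussianReal 0 1 {t | g t ≤ a ∧ b < f t} else 0) := by
  have hms : MeasurableSet {q : (ℝ × ℝ) × ℝ | q.1.2 < q.2 ∧ g q.1.1 ≤ q.1.2 ∧ q.2 < f q.1.1} := by
    have h1 : Measurable fun q : (ℝ × ℝ) × ℝ => q.1.2 := by fun_prop
    have h2 : Measurable fun q : (ℝ × ℝ) × ℝ => f q.1.1 := by fun_prop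
    have h3 : Measurable fun q : (ℝ × ℝ) × ℝ => g q.1.1 := by fun_prop
    exact (measurableSet_lt h1 measurable_snd).inter
      ((measurableSet_le h3 h1).inter (measurableSet_lt measurable_snd h2))
  have hm : Measurable fun q : (ℝ × ℝ) × ℝ =>
      (if q.1.2 < q.2 ∧ g q.1.1 ≤ q.1.2 ∧ q.2 < f q.1.1 then 1 else 0 : ℝ≥0∞) :=
    Measurable.ite hms measurable_const measurable_const
  simp_rw [← lintegral_triangle]
  rw [lintegral_lintegral_swap]
  · congr 1
    ext a
    rw [lintegral_lintegral_swap]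
    · congr 1
      ext b
      by_cases hab : a < b
      · simp only [hab, true_and, if_true]
        rw [← lintegral_indicator_one]
        · congr 1
          ext t
          simp [indicator]
        · exact (measurableSet_le hg measurable_const).inter (measurableSet_lt measurable_const hf)
      · simp [hab]
    · exact (hm.comp (by fun_prop : Measurable fun q : ℝ × ℝ => ((q.1, a), q.2))).aemeasurable
  · exact (hm.lintegral_prod_right' (ν := volume)).aemeasurable

/-- The square splits into the two positive parts. Each is an integral over `a < b` of the masses of
`{g ≤ a, b < f}`, which rearrangement does not increase. -/
theorem lintegral_rearr_sub_sq_le {f g : ℝ → ℝ} (hf : Measurable f) (hg : Measurable g) :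
    ∫⁻ t, ‖rearr f t - rearr g t‖ₑ ^ 2 ∂(gaussianReal 0 1) ≤
      ∫⁻ t, ‖f t - g t‖ₑ ^ 2 ∂(gaussianReal 0 1) := by
  have key : ∀ {f g : ℝ → ℝ}, Measurable f → Measurable g →
      ∫⁻ t, ENNReal.ofReal (max (rearr f t - rearr g t) 0 ^ 2 / 2) ∂(gaussianReal 0 1) ≤
        ∫⁻ t, ENNReal.ofReal (max (f t - g t) 0 ^ 2 / 2) ∂(gaussianReal 0 1) := by
    intro f g hf hg
    rw [lintegral_posPart_sq hf hg, lintegral_posPart_sq (measurable_rearr hf) (measurable_rearr hg)]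
    refine lintegral_mono fun a => lintegral_mono fun b => ?_
    dsimp only
    split_ifs
    · exact measure_rearr_le_lt_le hf hg a b
    · exact le_rfl
  have hm : ∀ {f g : ℝ → ℝ}, Measurable f → Measurable g →
      Measurable fun t => ENNReal.ofReal (max (f t - g t) 0 ^ 2 / 2) := by
    intro f g hf hg
    fun_prop
  simp_rw [enorm_sub_sq]
  rw [lintegral_add_left ((hm (measurable_rearr hf) (measurable_rearr hg)).const_mul 2),
    lintegral_add_left ((hm hf hg).const_mul 2),
    lintegral_const_mul _ (hm (measurable_rearr hf) (measurable_rearr hg)),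
    lintegral_const_mul _ (hm (measurable_rearr hg) (measurable_rearr hf)),
    lintegral_const_mul _ (hm hf hg), lintegral_const_mul _ (hm hg hf)]
  gcongr 2 * ?_ + 2 * ?_
  · exact key hf hg
  · exact key hg hf

/-! ### Splitting `γ` along `h`, and symmetrisation as a contraction of `L²(γ)`. -/

section Decomposition

variable {X : Type*} [NormedAddCommGroup X] [NormedSpace ℝ X] [MeasurableSpace X]

/-- The map `(x, t) ↦ x' + t h` with `x' = x - ℓ x h`, `h = Q ℓ`. -/
def shear (γ : Measure X) (ℓ : StrongDual ℝ X) : X × ℝ →L[ℝ] X :=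
  (ContinuousLinearMap.fst ℝ X ℝ -
    (ℓ.comp (ContinuousLinearMap.fst ℝ X ℝ)).smulRight (covOp γ ℓ)) +
    (ContinuousLinearMap.snd ℝ X ℝ).smulRight (covOp γ ℓ)

theorem shear_apply (γ : Measure X) (ℓ : StrongDual ℝ X) (x : X) (t : ℝ) :
    shear γ ℓ (x, t) = (x - ℓ x • covOp γ ℓ) + t • covOp γ ℓ := rfl

theorem ehrhard_eq_rearr (γ : Measure X) (ℓ : StrongDual ℝ X) (u : X → ℝ) (x : X) :
    ehrhard γ ℓ u x = rearr (fun τ => u (shear γ ℓ (x, τ))) (ℓ x) := rfl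

/-- Because `ℓ h = 1`, the points `x' + t h` have coordinate `t` and share the same `x'`, so one
rearrangement serves the whole line. -/
theorem ehrhard_shear {γ : Measure X} {ℓ : StrongDual ℝ X} (h1 : ℓ (covOp γ ℓ) = 1) (u : X → ℝ)
    (x : X) (t : ℝ) :
    ehrhard γ ℓ u (shear γ ℓ (x, t)) = rearr (fun τ => u (shear γ ℓ (x, τ))) t := by
  have hl : ℓ (shear γ ℓ (x, t)) = t := by simp [shear_apply, h1]
  have hs : ∀ τ, shear γ ℓ (shear γ ℓ (x, t), τ) = shear γ ℓ (x, τ) := by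
    intro τ
    rw [shear_apply γ ℓ (shear γ ℓ (x, t)), hl, shear_apply, shear_apply, add_sub_cancel_right]
  rw [ehrhard_eq_rearr, hl]
  simp_rw [hs]

theorem ehrhard_zero (γ : Measure X) (ℓ : StrongDual ℝ X) (x : X) : ehrhard γ ℓ (fun _ => 0) x = 0 :=
  rearr_zero (ℓ x)

theorem measurable_ehrhardExt [BorelSpace X] [SecondCountableTopology X]
    (γ : Measure X) (ℓ : StrongDual ℝ X) {v : X × ℝ → ℝ} (hv : Measurable v) :
    Measurable (ehrhardExt γ ℓ v) := by
  have hsh : Measurable (shear γ ℓ) := (shear γ ℓ).continuous.measurable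
  refine measurable_of_Ioi fun b => ?_
  have : ehrhardExt γ ℓ v ⁻¹' Ioi b = {p | gaussianReal 0 1 (Iic (ℓ p.1)) <
      gaussianReal 0 1 {τ | b < v (shear γ ℓ (p.1, τ), p.2)}} := by
    ext p
    exact lt_rearr_iff (f := fun τ => v (shear γ ℓ (p.1, τ), p.2)) (by fun_prop) b (ℓ p.1)
  rw [this]
  have hS : MeasurableSet {q : (X × ℝ) × ℝ | b < v (shear γ ℓ (q.1.1, q.2), q.1.2)} :=
    measurableSet_lt measurable_const (by fun_prop)
  exact measurableSet_lt (measurable_gaussian_Iic.comp (by fun_prop))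
    (measurable_measure_prodMk_left hS)

theorem measurable_ehrhard [BorelSpace X] [SecondCountableTopology X]
    (γ : Measure X) (ℓ : StrongDual ℝ X) {u : X → ℝ} (hu : Measurable u) :
    Measurable (ehrhard γ ℓ u) := by
  have h : ehrhard γ ℓ u = fun x => ehrhardExt γ ℓ (fun p => u p.1) (x, 0) := rfl
  rw [h]
  exact (measurable_ehrhardExt γ ℓ (hu.comp measurable_fst)).comp measurable_prodMk_right

variable [BorelSpace X] [CompleteSpace X] [SecondCountableTopology X]
  {γ : Measure X} [IsGaussian γ]

theorem dual_covOp (ℓ L : StrongDual ℝ X) : L (covOp γ ℓ) = ∫ x, ℓ x * L x ∂γ := by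
  have hi : Integrable (fun x => ℓ x • x) γ := by
    rw [← memLp_one_iff_integrable]
    exact (IsGaussian.memLp_two_fun_id (μ := γ)).smul (IsGaussian.memLp_dual γ ℓ 2 (by simp))
  rw [covOp, ← L.integral_comp_comm hi]
  simp

/-- Both sides are `∫ ℓ² dγ = |h|_H²`. -/
theorem dual_covOp_self {ℓ : StrongDual ℝ X} (hℓ : ‖ofDual γ ℓ‖ = 1) : ℓ (covOp γ ℓ) = 1 := by
  rw [dual_covOp, ← uncenteredCovarianceBilinDual_apply IsGaussian.memLp_two_id]
  change inner ℝ (StrongDual.toLp γ 2 ℓ) (StrongDual.toLp γ 2 ℓ) = (1 : ℝ)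
  rw [real_inner_self_eq_norm_sq]
  change ‖ofDual γ ℓ‖ ^ 2 = 1
  rw [hℓ, one_pow]

theorem variance_dual (hc : ∀ L : StrongDual ℝ X, ∫ x, L x ∂γ = 0) (L : StrongDual ℝ X) :
    Var[L; γ] = L (covOp γ L) := by
  rw [variance_of_integral_eq_zero (by fun_prop) (hc L), dual_covOp]
  simp_rw [sq]

/-- Centred Gaussian measures are determined by the variances of functionals. With `h = Q ℓ`, those
of `L - L(h) ℓ` under `γ` and of `L(h) t` under `γ₁` are `Var L - L(h)²` and `L(h)²`, which add up
to `Var L`. -/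
theorem map_shear (hc : ∀ L : StrongDual ℝ X, ∫ x, L x ∂γ = 0) {ℓ : StrongDual ℝ X}
    (h1 : ℓ (covOp γ ℓ) = 1) :
    (γ.prod (gaussianReal 0 1)).map (shear γ ℓ) = γ := by
  refine Measure.ext_of_charFunDual ?_
  ext L
  have hg : ∀ L : StrongDual ℝ ℝ, ∫ x, L x ∂(gaussianReal 0 1) = 0 := by
    intro L
    rw [IsGaussian.integral_dual]
    simp
  rw [charFunDual_map, charFunDual_prod,
    IsGaussian.charFunDual_eq_of_forall_strongDual_eq_zero hc,
    IsGaussian.charFunDual_eq_of_forall_strongDual_eq_zero hc,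
    IsGaussian.charFunDual_eq_of_forall_strongDual_eq_zero hg, ← Complex.exp_add, ← add_div,
    ← neg_add, ← Complex.ofReal_add]
  congr 4
  have hL : (L.comp (shear γ ℓ)).comp (.inl ℝ X ℝ) = L - L (covOp γ ℓ) • ℓ := by
    ext x
    simp [shear_apply, mul_comm]
  have hr : Var[(L.comp (shear γ ℓ)).comp (.inr ℝ X ℝ); gaussianReal 0 1] =
      L (covOp γ ℓ) ^ 2 := by
    have : ⇑((L.comp (shear γ ℓ)).comp (.inr ℝ X ℝ)) = fun t => L (covOp γ ℓ) * t := by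
      ext t
      simp [shear_apply, mul_comm]
    rw [this, variance_const_mul]
    simp
  have hQ : ∀ M : StrongDual ℝ X, M (covOp γ L) = L (covOp γ M) := by
    intro M
    rw [dual_covOp, dual_covOp]
    simp_rw [mul_comm]
  have hlin : ∀ M : StrongDual ℝ X, M (covOp γ (L - L (covOp γ ℓ) • ℓ)) =
      M (covOp γ L) - L (covOp γ ℓ) * M (covOp γ ℓ) := by
    intro M
    have hi : ∀ A B : StrongDual ℝ X, Integrable (fun x => A x * B x) γ := fun A B =>
      (IsGaussian.memLp_dual γ A 2 (by simp)).integrable_mul (IsGaussian.memLp_dual γ B 2 (by simp))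
    rw [dual_covOp _ M, dual_covOp L M, dual_covOp ℓ M, ← integral_const_mul, ← integral_sub (hi _ _)
      ((hi _ _).const_mul _)]
    congr 1
    ext x
    simp
    ring
  rw [hL, hr, variance_dual hc, variance_dual hc, hlin]
  simp only [sub_apply, smul_apply, smul_eq_mul, h1, hQ ℓ]
  ring

theorem measurePreserving_shear (hc : ∀ L : StrongDual ℝ X, ∫ x, L x ∂γ = 0) {ℓ : StrongDual ℝ X}
    (h1 : ℓ (covOp γ ℓ) = 1) :
    MeasurePreserving (shear γ ℓ) (γ.prod (gaussianReal 0 1)) γ :=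
  ⟨(shear γ ℓ).continuous.measurable, map_shear hc h1⟩

theorem lintegral_ehrhard_sub_sq_le (hc : ∀ L : StrongDual ℝ X, ∫ x, L x ∂γ = 0)
    {ℓ : StrongDual ℝ X} (h1 : ℓ (covOp γ ℓ) = 1) {u u' : X → ℝ} (hu : Measurable u)
    (hu' : Measurable u') :
    ∫⁻ x, ‖ehrhard γ ℓ u x - ehrhard γ ℓ u' x‖ₑ ^ 2 ∂γ ≤ ∫⁻ x, ‖u x - u' x‖ₑ ^ 2 ∂γ := by
  have hsh : Measurable (shear γ ℓ) := (shear γ ℓ).continuous.measurable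
  have hm := measurable_ehrhard γ ℓ hu
  have hm' := measurable_ehrhard γ ℓ hu'
  have hP := measurePreserving_shear hc h1
  rw [← hP.lintegral_comp (f := fun x => ‖ehrhard γ ℓ u x - ehrhard γ ℓ u' x‖ₑ ^ 2) (by fun_prop),
    ← hP.lintegral_comp (f := fun x => ‖u x - u' x‖ₑ ^ 2) (by fun_prop),
    lintegral_prod _ (by fun_prop), lintegral_prod _ (by fun_prop)]
  refine lintegral_mono fun x => ?_
  simp_rw [ehrhard_shear h1]
  exact lintegral_rearr_sub_sq_le (f := fun τ => u (shear γ ℓ (x, τ)))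
    (g := fun τ => u' (shear γ ℓ (x, τ))) (by fun_prop) (by fun_prop)

theorem lintegral_ehrhard_sq_le (hc : ∀ L : StrongDual ℝ X, ∫ x, L x ∂γ = 0)
    {ℓ : StrongDual ℝ X} (h1 : ℓ (covOp γ ℓ) = 1) {u : X → ℝ} (hu : Measurable u) :
    ∫⁻ x, ‖ehrhard γ ℓ u x‖ₑ ^ 2 ∂γ ≤ ∫⁻ x, ‖u x‖ₑ ^ 2 ∂γ := by
  simpa [ehrhard_zero] using lintegral_ehrhard_sub_sq_le hc h1 hu (measurable_const (a := (0 : ℝ)))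

/-- Symmetrisation reads `v` on lines, which are usually null sets. Still, `(x, y, τ) ↦ (x' + τ h,
y)` preserves measure, so on almost every line two versions of `v` agree almost everywhere, and
their rearrangements coincide. -/
theorem ehrhardExt_congr_ae (hc : ∀ L : StrongDual ℝ X, ∫ x, L x ∂γ = 0)
    {ℓ : StrongDual ℝ X} (h1 : ℓ (covOp γ ℓ) = 1) {m : Measure ℝ} [SFinite m]
    {v v' : X × ℝ → ℝ} (h : v =ᵐ[γ.prod m] v') :
    ehrhardExt γ ℓ v =ᵐ[γ.prod m] ehrhardExt γ ℓ v' := by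
  have hmp : MeasurePreserving (fun q : (X × ℝ) × ℝ => (shear γ ℓ (q.1.1, q.2), q.1.2))
      ((γ.prod m).prod (gaussianReal 0 1)) (γ.prod m) := by
    have e1 := measurePreserving_prodAssoc γ m (gaussianReal 0 1)
    have e2 := (MeasurePreserving.id γ).prod
      (Measure.measurePreserving_swap (μ := m) (ν := gaussianReal 0 1))
    have e3 := (measurePreserving_prodAssoc γ (gaussianReal 0 1) m).symm
    have e4 := (measurePreserving_shear hc h1).prod (MeasurePreserving.id m)
    exact e4.comp (e3.comp (e2.comp e1))
  have h2 := Measure.ae_ae_of_ae_prod (hmp.quasiMeasurePreserving.ae h)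
  filter_upwards [h2] with p hp
  exact congrFun (rearr_congr hp) (ℓ p.1)

end Decomposition

/-! ### Test functions determine a function almost everywhere. -/

/-- The finite measures with densities `f₊` and `f₋` have the same characteristic functional, so
they are equal. -/
theorem ae_eq_zero_of_integral_cos_sin {E : Type*} [NormedAddCommGroup E] [NormedSpace ℝ E]
    [MeasurableSpace E] [BorelSpace E] [SecondCountableTopology E] [CompleteSpace E]
    {μ : Measure E} [SFinite μ] {f : E → ℝ} (hf : Integrable f μ)
    (hcos : ∀ L : StrongDual ℝ E, ∫ x, f x * Real.cos (L x) ∂μ = 0)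
    (hsin : ∀ L : StrongDual ℝ E, ∫ x, f x * Real.sin (L x) ∂μ = 0) : f =ᵐ[μ] 0 := by
  have hfin : ∀ {g : E → ℝ}, Integrable g μ →
      IsFiniteMeasure (μ.withDensity fun x => ENNReal.ofReal (g x)) :=
    fun hg => isFiniteMeasure_withDensity_ofReal hg.2
  have hcf : ∀ {g : E → ℝ}, Integrable g μ → ∀ L : StrongDual ℝ E,
      charFunDual (μ.withDensity fun x => ENNReal.ofReal (g x)) L =
        ∫ x, ((max (g x) 0 : ℝ) : ℂ) * Complex.exp (L x * Complex.I) ∂μ := by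
    intro g hg L
    rw [charFunDual_apply, integral_withDensity_eq_integral_toReal_smul₀
      hg.aemeasurable.ennreal_ofReal (by simp)]
    simp [ENNReal.toReal_ofReal']
  have := hfin hf
  have := hfin hf.neg
  have hLm : ∀ L : StrongDual ℝ E, AEStronglyMeasurable
      (fun x => Complex.exp (L x * Complex.I)) μ := fun L =>
    (by fun_prop : Continuous fun x => Complex.exp (L x * Complex.I)).aestronglyMeasurable
  have hint : ∀ {g : E → ℝ}, Integrable g μ → ∀ L : StrongDual ℝ E,
      Integrable (fun x => (g x : ℂ) * Complex.exp (L x * Complex.I)) μ := by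
    intro g hg L
    refine hg.ofReal.mul_bdd (c := 1) (hLm L) (ae_of_all _ fun x => ?_)
    rw [Complex.norm_exp_ofReal_mul_I]
  have heq : (μ.withDensity fun x => ENNReal.ofReal (f x)) =
      μ.withDensity fun x => ENNReal.ofReal ((-f) x) := by
    refine Measure.ext_of_charFunDual ?_
    ext L
    rw [hcf hf, hcf hf.neg, ← sub_eq_zero, ← integral_sub (hint hf.pos_part L)
      (hint hf.neg.pos_part L)]
    have h1 : ∀ x, ((max (f x) 0 : ℝ) : ℂ) * Complex.exp (L x * Complex.I) -
        ((max ((-f) x) 0 : ℝ) : ℂ) * Complex.exp (L x * Complex.I) =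
        ((f x * Real.cos (L x) : ℝ) : ℂ) + ((f x * Real.sin (L x) : ℝ) : ℂ) * Complex.I := by
      intro x
      have h2 : max (f x) 0 - max ((-f) x) 0 = f x := by
        rcases le_total (f x) 0 with h | h <;> simp [h]
      rw [← sub_mul, ← Complex.ofReal_sub, h2, Complex.exp_mul_I]
      push_cast
      ring
    simp_rw [h1]
    have hc : Integrable (fun x => f x * Real.cos (L x)) μ :=
      hf.mul_bdd (c := 1) (by fun_prop : Continuous _).aestronglyMeasurable
        (ae_of_all _ fun x => Real.abs_cos_le_one _)
    have hs : Integrable (fun x => f x * Real.sin (L x)) μ :=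
      hf.mul_bdd (c := 1) (by fun_prop : Continuous _).aestronglyMeasurable
        (ae_of_all _ fun x => Real.abs_sin_le_one _)
    rw [integral_add hc.ofReal (hs.ofReal.mul_const _), integral_mul_const, integral_complex_ofReal,
      integral_complex_ofReal, hcos, hsin]
    simp
  rw [withDensity_eq_iff hf.aemeasurable.ennreal_ofReal hf.neg.aemeasurable.ennreal_ofReal
    hf.lintegral_lt_top.ne] at heq
  filter_upwards [heq] with x hx
  simp only [Pi.neg_apply] at hx
  rcases le_total (f x) 0 with h | h
  · rw [ENNReal.ofReal_of_nonpos h, eq_comm, ENNReal.ofReal_eq_zero] at hx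
    exact le_antisymm h (by simpa using hx)
  · rw [ENNReal.ofReal_of_nonpos (neg_nonpos.2 h), ENNReal.ofReal_eq_zero] at hx
    exact le_antisymm hx h

section TestFunctions

variable {X : Type*} [NormedAddCommGroup X] [NormedSpace ℝ X]

theorem IsCylindrical.continuous {φ : X → ℝ} (h : IsCylindrical φ) : Continuous φ := by
  obtain ⟨m, ℓ, f, hf, -, rfl⟩ := h
  exact hf.continuous.comp (by fun_prop)

theorem IsCylindrical.exists_bound {φ : X → ℝ} (h : IsCylindrical φ) :
    ∃ C, 0 ≤ C ∧ ∀ x, |φ x| ≤ C := by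
  obtain ⟨m, ℓ, f, -, ⟨C, hC⟩, rfl⟩ := h
  exact ⟨C, (abs_nonneg _).trans (hC 0).1, fun x => (hC _).1⟩

theorem isCylindrical_comp {g g' : ℝ → ℝ} (hg : ContDiff ℝ 1 g) (hg' : ∀ t, HasDerivAt g (g' t) t)
    {C : ℝ} (hC : ∀ t, |g t| ≤ C) (hC' : ∀ t, |g' t| ≤ C) (L : StrongDual ℝ X) :
    IsCylindrical fun x => g (L x) := by
  refine ⟨1, fun _ => L, fun z => g (z 0), hg.comp (contDiff_apply ℝ ℝ 0),
    ⟨C + C * ‖ContinuousLinearMap.proj (R := ℝ) (φ := fun _ : Fin 1 => ℝ) 0‖, fun z => ?_⟩, rfl⟩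
  have hC0 : 0 ≤ C := (abs_nonneg _).trans (hC 0)
  refine ⟨(hC _).trans (le_add_of_nonneg_right (by positivity)), ?_⟩
  have h : HasFDerivAt (fun z : Fin 1 → ℝ => g (z 0))
      (g' (z 0) • ContinuousLinearMap.proj (R := ℝ) (φ := fun _ : Fin 1 => ℝ) 0) z :=
    (hg' (z 0)).comp_hasFDerivAt z
      (ContinuousLinearMap.proj (R := ℝ) (φ := fun _ : Fin 1 => ℝ) 0).hasFDerivAt
  rw [h.fderiv, norm_smul]
  refine le_add_of_nonneg_of_le hC0 ?_
  gcongr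
  exact hC' _

theorem isCylindrical_cos (L : StrongDual ℝ X) : IsCylindrical fun x => Real.cos (L x) :=
  isCylindrical_comp Real.contDiff_cos Real.hasDerivAt_cos (C := 1) Real.abs_cos_le_one
    (fun t => by rw [abs_neg]; exact Real.abs_sin_le_one t) L

theorem isCylindrical_sin (L : StrongDual ℝ X) : IsCylindrical fun x => Real.sin (L x) :=
  isCylindrical_comp Real.contDiff_sin Real.hasDerivAt_sin (C := 1) Real.abs_sin_le_one
    Real.abs_cos_le_one L

theorem isCylindrical_one : IsCylindrical fun _ : X => (1 : ℝ) := by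
  simpa using isCylindrical_cos (0 : StrongDual ℝ X)

theorem IsTest.mul {η g : ℝ → ℝ} (h : IsTest η) (hg : ContDiff ℝ (⊤ : ℕ∞) g) :
    IsTest fun y => η y * g y :=
  ⟨h.1.mul hg, h.2.1.mul_right, (tsupport_mul_subset_left).trans h.2.2⟩

theorem IsTest.exists_Icc {η : ℝ → ℝ} (h : IsTest η) :
    ∃ a b, 0 < a ∧ a ≤ b ∧ ∀ y, y ∉ Icc a b → η y = 0 := by
  rcases (tsupport η).eq_empty_or_nonempty with he | hne
  · exact ⟨1, 1, one_pos, le_rfl, fun y _ => image_eq_zero_of_notMem_tsupport (he ▸ notMem_empty y)⟩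
  · have hc : IsCompact (tsupport η) := h.2.1
    obtain ⟨a, ha, hmin⟩ := hc.exists_isLeast hne
    obtain ⟨b, hb, hmax⟩ := hc.exists_isGreatest hne
    exact ⟨a, b, h.2.2 ha, hmin hb, fun y hy => image_eq_zero_of_notMem_tsupport
      fun hy' => hy ⟨hmin hy', hmax hy'⟩⟩

theorem isTest_of_eq_zero {η : ℝ → ℝ} (h : ContDiff ℝ (⊤ : ℕ∞) η) {a b : ℝ} (ha : 0 < a)
    (h0 : ∀ y, y ∉ Icc a b → η y = 0) : IsTest η := by
  have hs : tsupport η ⊆ Icc a b := closure_minimal (fun y hy => by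
    by_contra hn
    exact hy (h0 y hn)) isClosed_Icc
  exact ⟨h, isCompact_Icc.of_isClosed_subset (isClosed_tsupport η) hs,
    hs.trans fun y hy => ha.trans_le hy.1⟩

theorem IsTest.exists_bound {η : ℝ → ℝ} (h : IsTest η) : ∃ C, 0 ≤ C ∧ ∀ y, |η y| ≤ C := by
  obtain ⟨C, hC⟩ := h.1.continuous.bounded_above_of_compact_support h.2.1
  exact ⟨C, (norm_nonneg _).trans (hC 0), hC⟩

theorem exists_isTest_ne_zero (n : ℕ) : ∃ η : ℝ → ℝ, IsTest η ∧
    ∀ y ∈ Icc (1 / ((n : ℝ) + 1)) (n + 1), η y ≠ 0 := by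
  set N : ℝ := (n : ℝ) + 1 with hN
  have hN1 : 1 ≤ N := by rw [hN]; linarith [Nat.cast_nonneg (α := ℝ) n]
  have hi : 1 / N ≤ 1 := by rw [div_le_one (by linarith)]; exact hN1
  have hi0 : 0 < 1 / N := by positivity
  -- The inner ball is `[1/N, 2N + 1/N]`, which contains `[1/N, N]`; the outer ball starts at
  -- `1/(2N) > 0`.
  let η : ContDiffBump (N + 1 / N) :=
    { rIn := N, rOut := N + 1 / (2 * N), rIn_pos := by linarith
      rIn_lt_rOut := by have : 0 < 1 / (2 * N) := by positivity
                        linarith }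
  refine ⟨η, isTest_of_eq_zero η.contDiff (a := 1 / (2 * N)) (b := N + 1 / N + (N + 1 / (2 * N)))
    (by positivity) fun y hy => ?_, fun y hy => ?_⟩
  · have hh : 1 / N = 1 / (2 * N) + 1 / (2 * N) := by field_simp; norm_num
    refine η.zero_of_le_dist ?_
    rw [Real.dist_eq, le_abs]
    change N + 1 / (2 * N) ≤ _ ∨ N + 1 / (2 * N) ≤ _
    by_contra hcon
    rw [not_or, not_le, not_le] at hcon
    exact hy ⟨by linarith [hcon.2], by linarith [hcon.1]⟩
  · rw [η.one_of_mem_closedBall]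
    · exact one_ne_zero
    · rw [Metric.mem_closedBall, Real.dist_eq, abs_le]
      change -N ≤ _ ∧ _ ≤ N
      exact ⟨by linarith [hy.1], by linarith [hy.2]⟩

variable [MeasurableSpace X] [BorelSpace X] [SecondCountableTopology X] [CompleteSpace X]
  {γ : Measure X} [SFinite γ]

/-- The addition formulas write `η cos L` and `η sin L`, for `L` in the dual of `X × ℝ`, as sums of
products of a cylindrical function and a test function. So `F η` has vanishing Fourier integrals for
each `η`, and countably many `η` cover the half-line. -/
theorem ae_eq_zero_of_integral_test {F : X × ℝ → ℝ}
    (hF : ∀ (φ : X → ℝ) (η : ℝ → ℝ), IsCylindrical φ → IsTest η →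
      Integrable (fun p => F p * (φ p.1 * η p.2)) (γ.prod volume))
    (h0 : ∀ (φ : X → ℝ) (η : ℝ → ℝ), IsCylindrical φ → IsTest η →
      ∫ p, F p * (φ p.1 * η p.2) ∂(γ.prod volume) = 0) :
    ∀ᵐ p ∂(γ.prod volume), 0 < p.2 → F p = 0 := by
  have key : ∀ η, IsTest η → (fun p : X × ℝ => F p * η p.2) =ᵐ[γ.prod volume] 0 := by
    intro η hη
    have hsplit : ∀ (L : StrongDual ℝ (X × ℝ)) (p : X × ℝ),
        L p = (L.comp (.inl ℝ X ℝ)) p.1 + (L.comp (.inr ℝ X ℝ)) p.2 := fun L p => by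
      rw [L.comp_inl_add_comp_inr]
    have hco : ∀ L : StrongDual ℝ ℝ, IsTest fun y => η y * Real.cos (L y) := fun L =>
      hη.mul (Real.contDiff_cos.comp L.contDiff)
    have hsi : ∀ L : StrongDual ℝ ℝ, IsTest fun y => η y * Real.sin (L y) := fun L =>
      hη.mul (Real.contDiff_sin.comp L.contDiff)
    refine ae_eq_zero_of_integral_cos_sin ?_ (fun L => ?_) (fun L => ?_)
    · simpa using hF _ _ isCylindrical_one hη
    · set A := L.comp (.inl ℝ X ℝ)
      set B := L.comp (.inr ℝ X ℝ)
      have hr : ∀ p : X × ℝ, F p * η p.2 * Real.cos (L p) =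
          F p * (Real.cos (A p.1) * (η p.2 * Real.cos (B p.2))) -
          F p * (Real.sin (A p.1) * (η p.2 * Real.sin (B p.2))) := fun p => by
        rw [hsplit L p, Real.cos_add]
        ring
      simp_rw [hr]
      rw [integral_sub (hF _ _ (isCylindrical_cos A) (hco B)) (hF _ _ (isCylindrical_sin A) (hsi B)),
        h0 _ _ (isCylindrical_cos A) (hco B), h0 _ _ (isCylindrical_sin A) (hsi B), sub_zero]
    · set A := L.comp (.inl ℝ X ℝ)
      set B := L.comp (.inr ℝ X ℝ)
      have hr : ∀ p : X × ℝ, F p * η p.2 * Real.sin (L p) =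
          F p * (Real.sin (A p.1) * (η p.2 * Real.cos (B p.2))) +
          F p * (Real.cos (A p.1) * (η p.2 * Real.sin (B p.2))) := fun p => by
        rw [hsplit L p, Real.sin_add]
        ring
      simp_rw [hr]
      rw [integral_add (hF _ _ (isCylindrical_sin A) (hco B)) (hF _ _ (isCylindrical_cos A) (hsi B)),
        h0 _ _ (isCylindrical_sin A) (hco B), h0 _ _ (isCylindrical_cos A) (hsi B), add_zero]
  choose η hη hne using exists_isTest_ne_zero
  filter_upwards [ae_all_iff.2 fun n => key (η n) (hη n)] with p hp hpos
  obtain ⟨n, hn⟩ := exists_nat_gt (max p.2 (1 / p.2))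
  have h1 : p.2 < n := (le_max_left _ _).trans_lt hn
  have h2 : 1 / p.2 < n := (le_max_right _ _).trans_lt hn
  refine (mul_eq_zero.1 (hp n)).resolve_right (hne n p.2 ⟨?_, by linarith⟩)
  rw [div_le_iff₀ (by linarith)]
  rw [div_lt_iff₀ hpos] at h2
  nlinarith

end TestFunctions

/-! ### Vertical translations and the fundamental theorem of calculus for weak derivatives. -/

section Translation

variable {X : Type*} [MeasurableSpace X] {γ : Measure X}

theorem IsLocL2.integrable_mul [IsFiniteMeasure γ] {f χ : X × ℝ → ℝ} (hf : IsLocL2 γ f)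
    (hχ : AEStronglyMeasurable χ (γ.prod volume)) {C a b : ℝ} (ha : 0 < a)
    (hC : ∀ p, |χ p| ≤ C) (h0 : ∀ p, p.2 ∉ Icc a b → χ p = 0) :
    Integrable (fun p => f p * χ p) (γ.prod volume) := by
  have hfin : IsFiniteMeasure ((γ.prod (volume : Measure ℝ)).restrict (univ ×ˢ Icc a b)) := by
    refine ⟨?_⟩
    rw [Measure.restrict_apply_univ, Measure.prod_prod, Real.volume_Icc]
    exact ENNReal.mul_lt_top (measure_lt_top _ _) ENNReal.ofReal_lt_top
  have h1 : IntegrableOn f (univ ×ˢ Icc a b) (γ.prod volume) :=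
    (hf a b ha).integrable (by norm_num)
  have h2 : IntegrableOn (fun p => f p * χ p) (univ ×ˢ Icc a b) (γ.prod volume) :=
    Integrable.mul_bdd h1 hχ.restrict (ae_of_all _ hC)
  refine h2.integrable_of_forall_notMem_eq_zero fun p hp => ?_
  rw [h0 p (fun h => hp ⟨mem_univ _, h⟩), mul_zero]

theorem measurePreserving_translate [SFinite γ] (θ : ℝ) :
    MeasurePreserving (fun p : X × ℝ => (p.1, p.2 + θ)) (γ.prod volume) (γ.prod volume) :=
  (MeasurePreserving.id γ).prod (measurePreserving_add_right volume θ)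

theorem measurePreserving_translate_param [SFinite γ] (m : Measure ℝ) [SFinite m] :
    MeasurePreserving (fun q : ℝ × (X × ℝ) => (q.1, (q.2.1, q.2.2 + q.1)))
      (m.prod (γ.prod volume)) (m.prod (γ.prod volume)) := by
  refine (MeasurePreserving.id m).skew_product (g := fun θ (p : X × ℝ) => (p.1, p.2 + θ))
    (by fun_prop) (ae_of_all _ fun θ => (measurePreserving_translate θ).map_eq)

end Translation

/-- Averaging a test function over `[0, ε]` gives a test function with derivative
`η y - η (y - ε)`. -/
theorem IsTest.integral_translate {η : ℝ → ℝ} (h : IsTest η) {ε : ℝ} (hε : 0 < ε) :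
    IsTest (fun y => ∫ θ in (0 : ℝ)..ε, η (y - θ)) ∧
      deriv (fun y => ∫ θ in (0 : ℝ)..ε, η (y - θ)) = fun y => η y - η (y - ε) := by
  have hc := h.1.continuous
  set H : ℝ → ℝ := fun y => ∫ t in (0 : ℝ)..y, η t with hH
  have hd : ∀ y, HasDerivAt H (η y) y := fun y =>
    intervalIntegral.integral_hasDerivAt_right (hc.intervalIntegrable _ _)
      (hc.stronglyMeasurableAtFilter _ _) hc.continuousAt
  have hHs : ContDiff ℝ (⊤ : ℕ∞) H := by
    rw [contDiff_infty_iff_deriv]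
    refine ⟨fun y => (hd y).differentiableAt, ?_⟩
    rw [funext fun y => (hd y).deriv]
    exact h.1
  have heq : (fun y => ∫ θ in (0 : ℝ)..ε, η (y - θ)) = fun y => H y - H (y - ε) := by
    ext y
    rw [intervalIntegral.integral_comp_sub_left, sub_zero, hH]
    exact (intervalIntegral.integral_interval_sub_left (hc.intervalIntegrable _ _)
      (hc.intervalIntegrable _ _)).symm
  obtain ⟨a, b, ha, hab, h0⟩ := h.exists_Icc
  constructor
  · refine isTest_of_eq_zero (a := a) (b := b + ε) ?_ ha fun y hy => ?_
    · rw [heq]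
      exact hHs.sub (hHs.comp (contDiff_id.sub contDiff_const))
    · rw [intervalIntegral.integral_congr (g := fun _ => 0)]
      · simp
      · intro θ hθ
        rw [uIcc_of_le hε.le] at hθ
        exact h0 _ fun hm => hy ⟨by linarith [hm.1, hθ.1], by linarith [hm.2, hθ.2]⟩
  · rw [heq]
    ext y
    exact ((hd y).sub ((hd (y - ε)).comp_sub_const y ε)).deriv

section Identity

variable {X : Type*} [NormedAddCommGroup X] [NormedSpace ℝ X] [MeasurableSpace X] [BorelSpace X]
  {γ : Measure X} [IsFiniteMeasure γ]

theorem IsLocL2.integrable_mul_test {f : X × ℝ → ℝ} (hf : IsLocL2 γ f) {φ : X → ℝ} {η : ℝ → ℝ}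
    (hφ : IsCylindrical φ) (hη : Continuous η) {C a b : ℝ} (ha : 0 < a)
    (hC : ∀ y, |η y| ≤ C) (h0 : ∀ y, y ∉ Icc a b → η y = 0) :
    Integrable (fun p => f p * (φ p.1 * η p.2)) (γ.prod volume) := by
  obtain ⟨D, hD0, hD⟩ := hφ.exists_bound
  refine hf.integrable_mul (C := D * C) (a := a) (b := b) ?_ ha (fun p => ?_) (fun p hp => ?_)
  · have := hφ.continuous
    exact (by fun_prop : Continuous fun p : X × ℝ => φ p.1 * η p.2).aestronglyMeasurable
  · rw [abs_mul]
    exact mul_le_mul (hD _) (hC _) (abs_nonneg _) hD0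
  · rw [h0 _ hp, mul_zero]

variable [SecondCountableTopology X]

theorem HasWeakDy.integrable_translate {v w : X × ℝ → ℝ} (hv : HasWeakDy γ v w)
    (hw : Measurable w) {φ : X → ℝ} {η : ℝ → ℝ} (hφ : IsCylindrical φ) (hη : IsTest η) (ε : ℝ) :
    Integrable (fun q : ℝ × (X × ℝ) => w q.2 * (φ q.2.1 * η (q.2.2 - q.1)))
      ((volume.restrict (Ioc 0 ε)).prod (γ.prod volume)) := by
  obtain ⟨a, b, ha, hab, h0⟩ := hη.exists_Icc
  obtain ⟨C, hC0, hC⟩ := hη.exists_bound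
  obtain ⟨D, hD0, hD⟩ := hφ.exists_bound
  have hφc := hφ.continuous
  have hηc := hη.1.continuous
  have h1 : Integrable (fun p : X × ℝ => w p * (Prod.snd ⁻¹' Icc a (b + ε)).indicator 1 p)
      (γ.prod volume) := by
    refine hv.locL2_deriv.integrable_mul (C := 1) (a := a) (b := b + ε) ?_ ha (fun p => ?_)
      (fun p hp => ?_)
    · exact (measurable_one.indicator (measurable_snd measurableSet_Icc)).aestronglyMeasurable
    · by_cases hp : p.2 ∈ Icc a (b + ε)
      · rw [indicator_of_mem (by exact hp)]; simp
      · rw [indicator_of_notMem (by exact hp)]; simp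
    · exact indicator_of_notMem (by exact hp) _
  have h2 : Integrable (fun q : ℝ × (X × ℝ) =>
      (D * C) * (w q.2 * (Prod.snd ⁻¹' Icc a (b + ε)).indicator 1 q.2))
      ((volume.restrict (Ioc 0 ε)).prod (γ.prod volume)) :=
    (integrable_const (D * C)).mul_prod h1
  refine h2.norm.mono' ?_ ?_
  · have : Measurable fun q : ℝ × (X × ℝ) => φ q.2.1 * η (q.2.2 - q.1) :=
      (by fun_prop : Continuous fun q : ℝ × (X × ℝ) => φ q.2.1 * η (q.2.2 - q.1)).measurable
    exact ((hw.comp measurable_snd).mul this).aestronglyMeasurable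
  · have hae : ∀ᵐ q ∂((volume.restrict (Ioc 0 ε)).prod (γ.prod (volume : Measure ℝ))),
        q.1 ∈ Ioc 0 ε :=
      Measure.quasiMeasurePreserving_fst.ae (ae_restrict_mem measurableSet_Ioc)
    filter_upwards [hae] with q hq
    by_cases hp : q.2.2 ∈ Icc a (b + ε)
    · rw [indicator_of_mem (by exact hp), norm_mul, norm_mul, norm_mul, norm_mul, norm_mul,
        Pi.one_apply, norm_one, mul_one, mul_comm]
      refine mul_le_mul_of_nonneg_right (mul_le_mul ?_ ?_ (norm_nonneg _) (norm_nonneg _))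
        (norm_nonneg _)
      · exact (hD _).trans (le_abs_self _)
      · exact (hC _).trans (le_abs_self _)
    · rw [h0 (q.2.2 - q.1), mul_zero, mul_zero, norm_zero]
      · exact norm_nonneg _
      · intro hm
        exact hp ⟨by linarith [hm.1, hq.1], by linarith [hm.2, hq.2]⟩

variable [CompleteSpace X]

/-- A function with a weak vertical derivative satisfies the fundamental theorem of calculus. -/
theorem HasWeakDy.ae_sub_eq_integral {v w : X × ℝ → ℝ} (hv : HasWeakDy γ v w)
    (hw : Measurable w) {ε : ℝ} (hε : 0 < ε) :
    ∀ᵐ p ∂(γ.prod volume), 0 < p.2 →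
      v (p.1, p.2 + ε) - v p = ∫ θ in (0 : ℝ)..ε, w (p.1, p.2 + θ) := by
  have hmain : ∀ (φ : X → ℝ) (η : ℝ → ℝ), IsCylindrical φ → IsTest η →
      Integrable (fun p => (v (p.1, p.2 + ε) - v p - ∫ θ in (0 : ℝ)..ε, w (p.1, p.2 + θ)) *
        (φ p.1 * η p.2)) (γ.prod volume) ∧
      ∫ p, (v (p.1, p.2 + ε) - v p - ∫ θ in (0 : ℝ)..ε, w (p.1, p.2 + θ)) *
        (φ p.1 * η p.2) ∂(γ.prod volume) = 0 := by
    intro φ η hφ hη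
    obtain ⟨a, b, ha, hab, h0⟩ := hη.exists_Icc
    obtain ⟨C, hC0, hC⟩ := hη.exists_bound
    obtain ⟨hζ, hζ'⟩ := hη.integral_translate hε
    have hηc := hη.1.continuous
    have hτ := measurePreserving_translate (γ := γ) ε
    have i2 : Integrable (fun p => v p * (φ p.1 * η p.2)) (γ.prod volume) :=
      hv.locL2.integrable_mul_test hφ hηc ha hC h0
    have i1' : Integrable (fun p => v p * (φ p.1 * η (p.2 - ε))) (γ.prod volume) := by
      refine hv.locL2.integrable_mul_test (η := fun y => η (y - ε)) hφ (by fun_prop)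
        (a := a + ε) (b := b + ε) (by linarith) (fun y => hC _) fun y hy => h0 _ fun hm => hy ?_
      exact ⟨by linarith [hm.1], by linarith [hm.2]⟩
    have i1 : Integrable (fun p => v (p.1, p.2 + ε) * (φ p.1 * η p.2)) (γ.prod volume) := by
      have := hτ.integrable_comp_of_integrable i1'
      simpa [Function.comp_def] using this
    have e1 : ∫ p, v (p.1, p.2 + ε) * (φ p.1 * η p.2) ∂(γ.prod volume) =
        ∫ p, v p * (φ p.1 * η (p.2 - ε)) ∂(γ.prod volume) := by
      conv_rhs => rw [← hτ.map_eq, integral_map hτ.aemeasurable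
        (by rw [hτ.map_eq]; exact i1'.aestronglyMeasurable)]
      simp
    have k' := hv.integrable_translate hw hφ hη ε
    have hS := measurePreserving_translate_param (γ := γ) (volume.restrict (Ioc (0 : ℝ) ε))
    have k : Integrable (fun q : ℝ × (X × ℝ) => w (q.2.1, q.2.2 + q.1) * (φ q.2.1 * η q.2.2))
        ((volume.restrict (Ioc 0 ε)).prod (γ.prod volume)) := by
      have := hS.integrable_comp_of_integrable k'
      simpa [Function.comp_def] using this
    have ek : ∫ q : ℝ × (X × ℝ), w (q.2.1, q.2.2 + q.1) * (φ q.2.1 * η q.2.2)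
          ∂((volume.restrict (Ioc 0 ε)).prod (γ.prod volume)) =
        ∫ q : ℝ × (X × ℝ), w q.2 * (φ q.2.1 * η (q.2.2 - q.1))
          ∂((volume.restrict (Ioc 0 ε)).prod (γ.prod volume)) := by
      conv_rhs => rw [← hS.map_eq, integral_map hS.aemeasurable
        (by rw [hS.map_eq]; exact k'.aestronglyMeasurable)]
      simp
    have i3 : Integrable (fun p : X × ℝ => (∫ θ in (0 : ℝ)..ε, w (p.1, p.2 + θ)) *
        (φ p.1 * η p.2)) (γ.prod volume) := by
      have := k.integral_prod_right
      simpa only [integral_mul_const, intervalIntegral.integral_of_le hε.le] using this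
    have e3 : ∫ p : X × ℝ, (∫ θ in (0 : ℝ)..ε, w (p.1, p.2 + θ)) * (φ p.1 * η p.2)
          ∂(γ.prod volume) =
        ∫ p : X × ℝ, w p * (φ p.1 * ∫ θ in (0 : ℝ)..ε, η (p.2 - θ)) ∂(γ.prod volume) := by
      rw [integral_prod_symm _ k, integral_prod_symm _ k'] at ek
      simpa only [integral_mul_const, integral_const_mul,
        intervalIntegral.integral_of_le hε.le] using ek
    -- Both translations have been moved onto `η`. What remains is the definition of the weak
    -- derivative, tested with the integral of the translates of `η` over `[0, ε]`.
    have e4 := hv.integral_eq φ _ hφ hζ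
    rw [hζ'] at e4
    have e5 : ∫ p, v p * (φ p.1 * (η p.2 - η (p.2 - ε))) ∂(γ.prod volume) =
        ∫ p, v p * (φ p.1 * η p.2) ∂(γ.prod volume) -
          ∫ p, v p * (φ p.1 * η (p.2 - ε)) ∂(γ.prod volume) := by
      rw [← integral_sub i2 i1']
      congr 1
      ext p
      ring
    simp_rw [sub_mul]
    have i12 : Integrable (fun p => v (p.1, p.2 + ε) * (φ p.1 * η p.2) - v p * (φ p.1 * η p.2))
        (γ.prod volume) := i1.sub i2
    refine ⟨i12.sub i3, ?_⟩
    rw [integral_sub i12 i3, integral_sub i1 i2, e1, e3]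
    linarith
  filter_upwards [ae_eq_zero_of_integral_test (fun φ η hφ hη => (hmain φ η hφ hη).1)
    fun φ η hφ hη => (hmain φ η hφ hη).2] with p hp hpos
  exact sub_eq_zero.1 (hp hpos)

end Identity

theorem enorm_integral_sq_le {f : ℝ → ℝ} (hf : Measurable f) {ε : ℝ} (hε : 0 ≤ ε) :
    ‖∫ θ in (0 : ℝ)..ε, f θ‖ₑ ^ 2 ≤ ENNReal.ofReal ε * ∫⁻ θ in Ioc 0 ε, ‖f θ‖ₑ ^ 2 := by
  rw [intervalIntegral.integral_of_le hε]
  have h1 := ENNReal.lintegral_mul_le_Lp_mul_Lq (volume.restrict (Ioc 0 ε))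
    Real.HolderConjugate.two_two (f := fun _ => 1) (g := fun θ => ‖f θ‖ₑ) (by fun_prop)
    (by fun_prop)
  have h2 := (enorm_integral_le_lintegral_enorm (μ := volume.restrict (Ioc 0 ε)) f)
  simp only [Pi.mul_apply, one_mul, one_pow, lintegral_const, MeasurableSet.univ,
    Measure.restrict_apply, univ_inter, Real.volume_Ioc, sub_zero, ENNReal.rpow_two] at h1
  calc _ ≤ (ENNReal.ofReal ε ^ (1 / 2 : ℝ) * (∫⁻ θ in Ioc 0 ε, ‖f θ‖ₑ ^ 2) ^ (1 / 2 : ℝ)) ^ 2 :=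
        pow_le_pow_left' (h2.trans h1) 2
    _ = _ := by
        rw [← ENNReal.mul_rpow_of_nonneg _ _ (by norm_num), ← ENNReal.rpow_two, ← ENNReal.rpow_mul]
        norm_num

theorem HasWeakDy.ae_lintegral_sub_sq_le {X : Type*} [NormedAddCommGroup X] [NormedSpace ℝ X]
    [MeasurableSpace X] [BorelSpace X] [SecondCountableTopology X] [CompleteSpace X]
    {γ : Measure X} [IsFiniteMeasure γ] {v w : X × ℝ → ℝ} (hv : HasWeakDy γ v w)
    (hw : Measurable w) {ε : ℝ} (hε : 0 < ε) :
    ∀ᵐ y : ℝ, 0 < y → ∫⁻ x, ‖v (x, y + ε) - v (x, y)‖ₑ ^ 2 ∂γ ≤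
      ENNReal.ofReal ε * ∫⁻ θ in Ioc 0 ε, ∫⁻ x, ‖w (x, y + θ)‖ₑ ^ 2 ∂γ := by
  have h := Measure.ae_ae_of_ae_prod (Measure.measurePreserving_swap.quasiMeasurePreserving.ae
    (hv.ae_sub_eq_integral hw hε))
  filter_upwards [h] with y hy hpos
  rw [lintegral_lintegral_swap (by fun_prop), ← lintegral_const_mul _ (by fun_prop)]
  refine lintegral_mono_ae ?_
  filter_upwards [hy] with x hx
  rw [Prod.swap_prod_mk] at hx
  rw [hx hpos]
  exact enorm_integral_sq_le (f := fun θ => w (x, y + θ)) (by fun_prop) hε.le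

/-! ### Weak limits and changes of representative. -/

/-- Weak sequential compactness of balls in a Hilbert space, along a filter. -/
theorem exists_inner_eq_of_tendsto {H : Type*} [NormedAddCommGroup H] [InnerProductSpace ℝ H]
    [CompleteSpace H] {κ I : Type*} {l : Filter κ} [l.NeBot] {D : κ → H} {c : κ → ℝ} {C : ℝ}
    (hc : Tendsto c l (𝓝 1)) (hD : ∀ᶠ k in l, 0 < c k ∧ ‖D k‖ ≤ c k * C) {e : I → H} {t : I → ℝ}
    (ht : ∀ i, Tendsto (fun k => inner ℝ (D k) (e i)) l (𝓝 (t i))) :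
    ∃ u : H, ‖u‖ ≤ C ∧ ∀ i, inner ℝ u (e i) = t i := by
  -- Dividing by `c k → 1` puts all vectors in one ball of radius `C` without changing the limits;
  -- Banach-Alaoglu then applies along an ultrafilter finer than `l`.
  let x : κ → WeakDual ℝ H := fun k =>
    StrongDual.toWeakDual (InnerProductSpace.toDual ℝ H ((c k)⁻¹ • D k))
  have hK := WeakDual.isCompact_closedBall (𝕜 := ℝ) (0 : StrongDual ℝ H) C
  let U := Ultrafilter.of l
  have hU : (U : Filter κ) ≤ l := Ultrafilter.of_le l
  have hx : ∀ᶠ k in l, x k ∈ WeakDual.toStrongDual ⁻¹' Metric.closedBall (0 : StrongDual ℝ H) C := by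
    filter_upwards [hD] with k hk
    change InnerProductSpace.toDual ℝ H ((c k)⁻¹ • D k) ∈ Metric.closedBall _ C
    rw [mem_closedBall_zero_iff, LinearIsometryEquiv.norm_map, norm_smul, norm_inv,
      Real.norm_of_nonneg hk.1.le, inv_mul_le_iff₀ hk.1]
    exact hk.2
  obtain ⟨f, hf, hlim⟩ := hK.ultrafilter_le_nhds (U.map x)
    (le_principal_iff.2 (mem_map.2 (hU hx)))
  refine ⟨(InnerProductSpace.toDual ℝ H).symm (WeakDual.toStrongDual f), ?_, fun i => ?_⟩
  · rw [LinearIsometryEquiv.norm_map]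
    exact mem_closedBall_zero_iff.1 hf
  · rw [InnerProductSpace.toDual_symm_apply]
    have h1 : Tendsto (fun k => x k (e i)) U (𝓝 (f (e i))) :=
      ((WeakDual.eval_continuous (𝕜 := ℝ) (e i)).tendsto f).comp hlim
    have h2 : Tendsto (fun k => x k (e i)) U (𝓝 ((1 : ℝ)⁻¹ * t i)) := by
      refine Tendsto.mono_left ?_ hU
      refine ((hc.inv₀ one_ne_zero).mul (ht i)).congr fun k => ?_
      change _ = InnerProductSpace.toDual ℝ H ((c k)⁻¹ • D k) (e i)
      rw [InnerProductSpace.toDual_apply_apply, real_inner_smul_left]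
    simpa using tendsto_nhds_unique h1 h2

theorem lintegral_enorm_sq_eq {α F : Type*} [MeasurableSpace α] [NormedAddCommGroup F]
    (μ : Measure α) (f : α → F) : ∫⁻ x, ‖f x‖ₑ ^ 2 ∂μ = eLpNorm f 2 μ ^ 2 := by
  have h := eLpNorm_nnreal_pow_eq_lintegral (μ := μ) (f := f) (p := 2) two_ne_zero
  norm_num at h
  exact h.symm

theorem memLp_two_iff {α F : Type*} [MeasurableSpace α] [NormedAddCommGroup F]
    {μ : Measure α} {f : α → F} (hf : AEStronglyMeasurable f μ) :
    MemLp f 2 μ ↔ ∫⁻ x, ‖f x‖ₑ ^ 2 ∂μ < ⊤ := by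
  rw [lintegral_enorm_sq_eq, MemLp, and_iff_right hf]
  simp

section Congr

variable {X : Type*} [MeasurableSpace X] {γ : Measure X}

theorem IsLocL2.exists_measurable {f : X × ℝ → ℝ} (hf : IsLocL2 γ f) :
    ∃ g : X × ℝ → ℝ, Measurable g ∧ ∀ᵐ p ∂(γ.prod volume), 0 < p.2 → f p = g p := by
  have hU : (univ : Set X) ×ˢ Ioi (0 : ℝ) =
      ⋃ n : ℕ, univ ×ˢ Icc (1 / ((n : ℝ) + 1)) ((n : ℝ) + 1) := by
    ext p
    simp only [mem_prod, mem_univ, true_and, mem_Ioi, mem_iUnion, mem_Icc]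
    constructor
    · intro hp
      obtain ⟨n, hn⟩ := exists_nat_gt (max p.2 (1 / p.2))
      have h1 : p.2 < n := (le_max_left _ _).trans_lt hn
      have h2 : 1 / p.2 < n := (le_max_right _ _).trans_lt hn
      refine ⟨n, ?_, by linarith⟩
      rw [div_le_iff₀ (by linarith)]
      rw [div_lt_iff₀ hp] at h2
      nlinarith
    · rintro ⟨n, hn, -⟩
      exact lt_of_lt_of_le (by positivity) hn
  have h : AEStronglyMeasurable f ((γ.prod volume).restrict (univ ×ˢ Ioi 0)) := by
    rw [hU, aestronglyMeasurable_iUnion_iff]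
    exact fun n => (hf _ _ (by positivity)).1
  refine ⟨h.mk f, h.stronglyMeasurable_mk.measurable, ?_⟩
  filter_upwards [(ae_restrict_iff' (MeasurableSet.univ.prod measurableSet_Ioi)).1 h.ae_eq_mk]
    with p hp hpos
  exact hp ⟨mem_univ _, hpos⟩

theorem IsLocL2.congr {f g : X × ℝ → ℝ} (hf : IsLocL2 γ f)
    (h : ∀ᵐ p ∂(γ.prod volume), 0 < p.2 → f p = g p) : IsLocL2 γ g := by
  intro a b ha
  refine (memLp_congr_ae ?_).1 (hf a b ha)
  filter_upwards [ae_restrict_of_ae h, ae_restrict_mem (MeasurableSet.univ.prod measurableSet_Icc)]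
    with p hp hm
  exact hp (ha.trans_le hm.2.1)

theorem integral_mul_congr_of_pos {f g : X × ℝ → ℝ}
    (h : ∀ᵐ p ∂(γ.prod volume), 0 < p.2 → f p = g p) (φ : X → ℝ) {η : ℝ → ℝ}
    (hη : ∀ y ≤ 0, η y = 0) :
    ∫ p, f p * (φ p.1 * η p.2) ∂(γ.prod volume) = ∫ p, g p * (φ p.1 * η p.2) ∂(γ.prod volume) := by
  refine integral_congr_ae ?_
  filter_upwards [h] with p hp
  rcases lt_or_ge 0 p.2 with hpos | hle
  · rw [hp hpos]
  · rw [hη _ hle, mul_zero, mul_zero, mul_zero]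

theorem IsTest.eq_zero_of_nonpos {η : ℝ → ℝ} (h : IsTest η) {y : ℝ} (hy : y ≤ 0) : η y = 0 :=
  image_eq_zero_of_notMem_tsupport fun hm => not_lt.2 hy (h.2.2 hm)

theorem IsTest.isTest_deriv {η : ℝ → ℝ} (h : IsTest η) : IsTest (deriv η) :=
  ⟨(contDiff_infty_iff_deriv.1 h.1).2, h.2.1.deriv, (tsupport_deriv_subset).trans h.2.2⟩

theorem energy_congr [IsFiniteMeasure γ] {s : ℝ} {f g : X × ℝ → ℝ}
    (h : ∀ᵐ p ∂(γ.prod volume), 0 < p.2 → f p = g p) : energy γ s f = energy γ s g := by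
  have hac : extMeasure γ s ≪ γ.prod (volume.restrict (Ioi 0)) :=
    Measure.AbsolutelyContinuous.rfl.prod (withDensity_absolutelyContinuous _ _)
  refine lintegral_congr_ae (hac.ae_le ?_)
  have h1 : γ.prod ((volume : Measure ℝ).restrict (Ioi 0)) =
      (γ.prod volume).restrict (univ ×ˢ Ioi 0) := by
    rw [← Measure.prod_restrict, Measure.restrict_univ]
  rw [h1]
  filter_upwards [ae_restrict_of_ae h, ae_restrict_mem (MeasurableSet.univ.prod measurableSet_Ioi)]
    with p hp hm
  rw [hp hm.2]

theorem HasWeakDy.congr {X : Type*} [NormedAddCommGroup X] [NormedSpace ℝ X] [MeasurableSpace X]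
    {γ : Measure X} {v w v' w' : X × ℝ → ℝ} (hv : HasWeakDy γ v w)
    (h : ∀ᵐ p ∂(γ.prod volume), 0 < p.2 → v p = v' p)
    (h' : ∀ᵐ p ∂(γ.prod volume), 0 < p.2 → w p = w' p) : HasWeakDy γ v' w' where
  locL2 := hv.locL2.congr h
  locL2_deriv := hv.locL2_deriv.congr h'
  integral_eq φ η hφ hη := by
    rw [← integral_mul_congr_of_pos h φ fun y hy => hη.isTest_deriv.eq_zero_of_nonpos hy,
      ← integral_mul_congr_of_pos h' φ fun y hy => hη.eq_zero_of_nonpos hy]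
    exact hv.integral_eq φ η hφ hη

end Congr

/-! ### The weight `y^{1-2s}` and weighted difference quotients. -/

section Weight

variable {X : Type*} [MeasurableSpace X] {γ : Measure X} [IsFiniteMeasure γ]

theorem extMeasure_eq_withDensity (γ : Measure X) [IsFiniteMeasure γ] (s : ℝ) :
    extMeasure γ s = ((γ.prod volume).restrict (univ ×ˢ Ioi 0)).withDensity
      fun p => ENNReal.ofReal (p.2 ^ (1 - 2 * s)) := by
  rw [extMeasure, prod_withDensity_right (by fun_prop), ← Measure.prod_restrict,
    Measure.restrict_univ]

theorem lintegral_extMeasure (s : ℝ) {f : X × ℝ → ℝ≥0∞} (hf : Measurable f) :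
    ∫⁻ p, f p ∂(extMeasure γ s) =
      ∫⁻ y in Ioi 0, ENNReal.ofReal (y ^ (1 - 2 * s)) * ∫⁻ x, f (x, y) ∂γ := by
  rw [extMeasure, lintegral_prod_symm _ hf.aemeasurable, lintegral_withDensity_eq_lintegral_mul _
    (by fun_prop) (hf.lintegral_prod_left')]
  rfl

/-- Dividing the test function by the weight turns the unweighted pairing into an inner product of
`L²(y^{1-2s} dγ dy)`, where the compactness argument takes place. -/
theorem integral_extMeasure_mul (s : ℝ) (F : X × ℝ → ℝ) (φ : X → ℝ) {η : ℝ → ℝ}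
    (hη : ∀ y ≤ 0, η y = 0) :
    ∫ p, F p * (p.2 ^ (-(1 - 2 * s)) * (φ p.1 * η p.2)) ∂(extMeasure γ s) =
      ∫ p, F p * (φ p.1 * η p.2) ∂(γ.prod volume) := by
  rw [extMeasure_eq_withDensity, integral_withDensity_eq_integral_toReal_smul (by fun_prop)
    (ae_of_all _ fun _ => ENNReal.ofReal_lt_top),
    ← setIntegral_eq_integral_of_forall_compl_eq_zero (μ := γ.prod volume)
      (s := univ ×ˢ Ioi (0 : ℝ)) (f := fun p => F p * (φ p.1 * η p.2))]
  · refine setIntegral_congr_fun (MeasurableSet.univ.prod (measurableSet_Ioi (a := (0 : ℝ))))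
      fun p hp => ?_
    have h0 : (0 : ℝ) < p.2 := hp.2
    have h1 : p.2 ^ (1 - 2 * s) ≠ 0 := (Real.rpow_pos_of_pos h0 _).ne'
    rw [ENNReal.toReal_ofReal (Real.rpow_nonneg h0.le _), Real.rpow_neg h0.le, smul_eq_mul]
    field_simp
  · intro p hp
    rw [hη, mul_zero, mul_zero]
    exact not_lt.1 fun h : 0 < p.2 => hp ⟨mem_univ _, h⟩

theorem exists_rpow_le (q : ℝ) {a b : ℝ} (ha : 0 < a) :
    ∃ C, 0 ≤ C ∧ ∀ y ∈ Icc a b, y ^ q ≤ C := by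
  have hc : ContinuousOn (fun y : ℝ => y ^ q) (Icc a b) := fun y hy =>
    (Real.continuousAt_rpow_const _ _ (Or.inl (ha.trans_le hy.1).ne')).continuousWithinAt
  obtain ⟨C, hC⟩ := isCompact_Icc.exists_bound_of_continuousOn hc
  exact ⟨max C 0, le_max_right _ _, fun y hy => (le_abs_self _).trans
    ((hC y hy).trans (le_max_left _ _))⟩

theorem isLocL2_of_energy_lt_top {s : ℝ} {f : X × ℝ → ℝ} (hf : Measurable f)
    (h : energy γ s f < ⊤) : IsLocL2 γ f := by
  intro a b ha
  rw [memLp_two_iff hf.aestronglyMeasurable]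
  obtain ⟨C, hC0, hC⟩ := exists_rpow_le (-(1 - 2 * s)) (b := b) ha
  have hm : Measurable fun p : X × ℝ => ENNReal.ofReal (p.2 ^ (1 - 2 * s)) := by fun_prop
  calc ∫⁻ p in univ ×ˢ Icc a b, ‖f p‖ₑ ^ 2 ∂(γ.prod volume)
      ≤ ∫⁻ p in univ ×ˢ Icc a b, ENNReal.ofReal C *
          (ENNReal.ofReal (p.2 ^ (1 - 2 * s)) * ‖f p‖ₑ ^ 2) ∂(γ.prod volume) := by
        refine setLIntegral_mono (by fun_prop) fun p hp => ?_
        have h0 : 0 < p.2 := ha.trans_le hp.2.1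
        have h1 : 1 ≤ C * p.2 ^ (1 - 2 * s) := by
          have := mul_le_mul_of_nonneg_right (hC p.2 hp.2) (Real.rpow_nonneg h0.le (1 - 2 * s))
          rwa [← Real.rpow_add h0, neg_add_cancel, Real.rpow_zero] at this
        rw [← mul_assoc, ← ENNReal.ofReal_mul hC0]
        calc ‖f p‖ₑ ^ 2 = ENNReal.ofReal 1 * ‖f p‖ₑ ^ 2 := by simp
          _ ≤ _ := by gcongr
    _ ≤ ∫⁻ p in univ ×ˢ Ioi 0, ENNReal.ofReal C *
          (ENNReal.ofReal (p.2 ^ (1 - 2 * s)) * ‖f p‖ₑ ^ 2) ∂(γ.prod volume) :=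
        lintegral_mono_set (prod_mono le_rfl fun y hy => ha.trans_le hy.1)
    _ = ENNReal.ofReal C * energy γ s f := by
        rw [lintegral_const_mul _ (by fun_prop), energy, extMeasure_eq_withDensity,
          lintegral_withDensity_eq_lintegral_mul _ hm (by fun_prop)]
        rfl
    _ < ⊤ := ENNReal.mul_lt_top ENNReal.ofReal_lt_top h

end Weight

/-- This governs the choice of step `δ ^ 2` above height `δ`: for `q > -1` the ratio of weights is
at most `(y + θ) / y ≤ 1 + δ ^ 2 / δ`. With `q = 1 - 2s` the condition is `s < 1`. -/
theorem rpow_le_one_add_mul_rpow {q : ℝ} (hq : -1 < q) {δ y θ : ℝ} (hδ : 0 < δ) (hy : δ ≤ y)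
    (hθ : 0 ≤ θ) (hθ' : θ ≤ δ ^ 2) : y ^ q ≤ (1 + δ) * (y + θ) ^ q := by
  have hy0 : 0 < y := hδ.trans_le hy
  have hz : 0 < y + θ := by linarith
  have h1 : (y / (y + θ)) ^ q ≤ (y / (y + θ)) ^ (-1 : ℝ) :=
    Real.rpow_le_rpow_of_exponent_ge (by positivity) ((div_le_one hz).2 (by linarith)) hq.le
  rw [Real.rpow_neg_one, inv_div, Real.div_rpow hy0.le hz.le,
    div_le_iff₀ (Real.rpow_pos_of_pos hz _)] at h1
  refine h1.trans (mul_le_mul_of_nonneg_right ?_ (Real.rpow_nonneg hz.le _))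
  rw [div_le_iff₀ hy0]
  nlinarith

/-- The vertical difference quotient of step `δ ^ 2`, cut off below height `δ`. -/
def diffQuot {X : Type*} (f : X × ℝ → ℝ) (δ : ℝ) (p : X × ℝ) : ℝ :=
  if δ ≤ p.2 then (f (p.1, p.2 + δ ^ 2) - f p) / δ ^ 2 else 0

section DiffQuot

variable {X : Type*} [MeasurableSpace X] {γ : Measure X}

theorem measurable_diffQuot {f : X × ℝ → ℝ} (hf : Measurable f) (δ : ℝ) :
    Measurable (diffQuot f δ) :=
  Measurable.ite (measurableSet_le measurable_const measurable_snd) (by fun_prop) measurable_const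

theorem setLIntegral_Ioi_translate_le (g : ℝ → ℝ≥0∞) {θ : ℝ} (hθ : 0 ≤ θ) :
    ∫⁻ y in Ioi 0, g (y + θ) ≤ ∫⁻ y in Ioi 0, g y := by
  have h := (measurePreserving_add_right volume θ).setLIntegral_comp_preimage_emb
    (MeasurableEquiv.addRight θ).measurableEmbedding g (Ioi θ)
  have h2 : (fun y => y + θ) ⁻¹' Ioi θ = Ioi 0 := by
    ext y
    simp
  rw [h2] at h
  rw [h]
  exact lintegral_mono_set (Ioi_subset_Ioi hθ)

/-- The factor `1 / ε²` of the squared quotient and the `ε` of the hypothesis leave an average over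
`θ ∈ (0, ε]`. Moving the weight from `y` to `y + θ` costs `1 + δ`, and translating upwards does not
increase an integral over the half-line. -/
theorem energy_diffQuot_le [IsFiniteMeasure γ] {f w : X × ℝ → ℝ} (hf : Measurable f)
    (hw : Measurable w) {s : ℝ} (hs : s < 1) {δ : ℝ} (hδ : 0 < δ)
    (h : ∀ᵐ y : ℝ, 0 < y → ∫⁻ x, ‖f (x, y + δ ^ 2) - f (x, y)‖ₑ ^ 2 ∂γ ≤
      ENNReal.ofReal (δ ^ 2) * ∫⁻ θ in Ioc 0 (δ ^ 2), ∫⁻ x, ‖w (x, y + θ)‖ₑ ^ 2 ∂γ) :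
    energy γ s (diffQuot f δ) ≤ ENNReal.ofReal (1 + δ) * energy γ s w := by
  have hd := measurable_diffQuot hf δ
  have hε : 0 < δ ^ 2 := by positivity
  set ε := δ ^ 2 with hεdef
  set q := 1 - 2 * s with hq
  have hq1 : -1 < q := by rw [hq]; linarith
  set g : ℝ → ℝ≥0∞ := fun y => ENNReal.ofReal (y ^ q) * ∫⁻ x, ‖w (x, y)‖ₑ ^ 2 ∂γ with hg
  have hgm : Measurable g :=
    Measurable.mul (by fun_prop) (Measurable.lintegral_prod_left' (f := fun p => ‖w p‖ₑ ^ 2)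
      (by fun_prop))
  have hpt : ∀ᵐ y : ℝ, 0 < y → ENNReal.ofReal (y ^ q) * ∫⁻ x, ‖diffQuot f δ (x, y)‖ₑ ^ 2 ∂γ ≤
      ENNReal.ofReal ((1 + δ) / ε) * ∫⁻ θ in Ioc 0 ε, g (y + θ) := by
    filter_upwards [h] with y hy hpos
    by_cases hyd : δ ≤ y
    · have h1 : ∀ x, ‖diffQuot f δ (x, y)‖ₑ ^ 2 =
          ENNReal.ofReal (1 / ε ^ 2) * ‖f (x, y + ε) - f (x, y)‖ₑ ^ 2 := by
        intro x
        rw [diffQuot, if_pos hyd, div_eq_mul_inv, enorm_mul, mul_pow, mul_comm,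
          Real.enorm_eq_ofReal (by positivity), ← ENNReal.ofReal_pow (by positivity), one_div,
          inv_pow]
      simp_rw [h1]
      rw [lintegral_const_mul _ (by fun_prop)]
      calc ENNReal.ofReal (y ^ q) * (ENNReal.ofReal (1 / ε ^ 2) *
            ∫⁻ x, ‖f (x, y + ε) - f (x, y)‖ₑ ^ 2 ∂γ)
          ≤ ENNReal.ofReal (y ^ q) * (ENNReal.ofReal (1 / ε ^ 2) * (ENNReal.ofReal ε *
            ∫⁻ θ in Ioc 0 ε, ∫⁻ x, ‖w (x, y + θ)‖ₑ ^ 2 ∂γ)) := by gcongr; exact hy hpos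
        _ = ENNReal.ofReal (1 / ε) * ∫⁻ θ in Ioc 0 ε, ENNReal.ofReal (y ^ q) *
            ∫⁻ x, ‖w (x, y + θ)‖ₑ ^ 2 ∂γ := by
          rw [lintegral_const_mul _ (Measurable.lintegral_prod_left'
            (f := fun p : X × ℝ => ‖w (p.1, y + p.2)‖ₑ ^ 2) (by fun_prop)),
            ← mul_assoc (ENNReal.ofReal (1 / ε ^ 2)), ← ENNReal.ofReal_mul (by positivity)]
          have : 1 / ε ^ 2 * ε = 1 / ε := by field_simp
          rw [this]
          ring
        _ ≤ ENNReal.ofReal (1 / ε) * ∫⁻ θ in Ioc 0 ε, ENNReal.ofReal (1 + δ) * g (y + θ) := by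
          gcongr ENNReal.ofReal (1 / ε) * ?_
          refine setLIntegral_mono (by fun_prop) fun θ hθ => ?_
          rw [hg, ← mul_assoc, ← ENNReal.ofReal_mul (by positivity)]
          gcongr
          exact rpow_le_one_add_mul_rpow hq1 hδ hyd hθ.1.le hθ.2
        _ = _ := by
          rw [lintegral_const_mul _ (by fun_prop), ← mul_assoc, ← ENNReal.ofReal_mul (by positivity)]
          congr 2
          ring
    · simp [diffQuot, hyd]
  have e1 : energy γ s w = ∫⁻ y in Ioi 0, g y := lintegral_extMeasure s (by fun_prop)
  rw [energy, lintegral_extMeasure s (by fun_prop), e1]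
  calc _ ≤ ∫⁻ y in Ioi 0, ENNReal.ofReal ((1 + δ) / ε) * ∫⁻ θ in Ioc 0 ε, g (y + θ) := by
        refine lintegral_mono_ae ?_
        filter_upwards [ae_restrict_of_ae hpt, ae_restrict_mem measurableSet_Ioi] with y hy hpos
        exact hy hpos
    _ = ENNReal.ofReal ((1 + δ) / ε) * ∫⁻ θ in Ioc 0 ε, ∫⁻ y in Ioi 0, g (y + θ) := by
        rw [lintegral_const_mul _ (Measurable.lintegral_prod_right'
          (f := fun p : ℝ × ℝ => g (p.1 + p.2)) (by fun_prop)),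
          lintegral_lintegral_swap (by fun_prop)]
    _ ≤ ENNReal.ofReal ((1 + δ) / ε) * ∫⁻ θ in Ioc 0 ε, ∫⁻ y in Ioi 0, g y := by
        gcongr ENNReal.ofReal _ * ?_
        exact setLIntegral_mono measurable_const fun θ hθ => setLIntegral_Ioi_translate_le g hθ.1.le
    _ = _ := by
        rw [lintegral_const, Measure.restrict_apply_univ, Real.volume_Ioc, sub_zero,
          mul_comm (∫⁻ y in Ioi 0, g y), ← mul_assoc, ← ENNReal.ofReal_mul (by positivity)]
        congr 2
        field_simp

end DiffQuot

/-! ### From bounded difference quotients to a weak derivative. -/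

section Limit

variable {X : Type*} [NormedAddCommGroup X] [NormedSpace ℝ X] [MeasurableSpace X] [BorelSpace X]
  {γ : Measure X} [IsFiniteMeasure γ]

theorem IsTest.tendsto_integral_quotient {f : X × ℝ → ℝ} (hf : IsLocL2 γ f) {φ : X → ℝ}
    {η : ℝ → ℝ} (hφ : IsCylindrical φ) (hη : IsTest η) :
    Tendsto (fun ε : ℝ => ∫ p, f p * (φ p.1 * ((η (p.2 - ε) - η p.2) / ε)) ∂(γ.prod volume))
      (𝓝[>] 0) (𝓝 (-∫ p, f p * (φ p.1 * deriv η p.2) ∂(γ.prod volume))) := by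
  obtain ⟨a, b, ha, hab, h0⟩ := hη.exists_Icc
  obtain ⟨M, hM0, hM⟩ := hη.isTest_deriv.exists_bound
  obtain ⟨C, hC0, hC⟩ := hφ.exists_bound
  have hφc := hφ.continuous
  have hηc := hη.1.continuous
  have hdiff : Differentiable ℝ η := (contDiff_infty_iff_deriv.1 hη.1).1
  have hlip : ∀ y ε, 0 < ε → |(η (y - ε) - η y) / ε| ≤ M := by
    intro y ε hε
    have := convex_univ.norm_image_sub_le_of_norm_deriv_le (f := η) (C := M) (x := y) (y := y - ε)
      (fun z _ => hdiff z) (fun z _ => hM z) (mem_univ _) (mem_univ _)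
    rw [Real.norm_eq_abs, Real.norm_eq_abs, sub_sub_cancel_left, abs_neg, abs_of_pos hε] at this
    rwa [abs_div, abs_of_pos hε, div_le_iff₀ hε]
  rw [← integral_neg]
  have hint : Integrable (fun p : X × ℝ => f p *
      (Prod.snd ⁻¹' Icc a (b + 1)).indicator (fun _ => C * M) p) (γ.prod volume) := by
    refine hf.integrable_mul (C := C * M) (a := a) (b := b + 1) ?_ ha (fun p => ?_) (fun p hp => ?_)
    · exact (measurable_const.indicator (measurable_snd measurableSet_Icc)).aestronglyMeasurable
    · by_cases hp : p.2 ∈ Icc a (b + 1)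
      · rw [indicator_of_mem (by exact hp), abs_of_nonneg (by positivity)]
      · rw [indicator_of_notMem (by exact hp), abs_zero]; positivity
    · exact indicator_of_notMem (by exact hp) _
  have hη' : ∀ y ε, 0 < ε → ε ≤ 1 → y ∉ Icc a (b + 1) → (η (y - ε) - η y) / ε = 0 := by
    intro y ε hε hε1 hy
    rw [h0 y fun hm => hy ⟨hm.1, by linarith [hm.2]⟩,
      h0 (y - ε) fun hm => hy ⟨by linarith [hm.1], by linarith [hm.2]⟩, sub_zero, zero_div]
  have hsmall : ∀ᶠ ε : ℝ in 𝓝[>] 0, 0 < ε ∧ ε ≤ 1 := by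
    filter_upwards [Ioc_mem_nhdsGT (zero_lt_one' ℝ)] with ε hε
    exact hε
  refine tendsto_integral_filter_of_dominated_convergence _ ?_ ?_ hint.norm ?_
  · filter_upwards [hsmall] with ε hε
    refine (hf.integrable_mul_test (η := fun y => (η (y - ε) - η y) / ε) (C := M) (a := a)
      (b := b + 1) hφ (by fun_prop) ha (fun y => hlip y ε hε.1)
      (fun y hy => hη' y ε hε.1 hε.2 hy)).aestronglyMeasurable
  · filter_upwards [hsmall] with ε hε
    refine ae_of_all _ fun p => ?_
    by_cases hp : p.2 ∈ Icc a (b + 1)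
    · rw [indicator_of_mem (by exact hp), norm_mul, norm_mul, norm_mul]
      refine mul_le_mul_of_nonneg_left (mul_le_mul (hC _) (hlip _ _ hε.1) (abs_nonneg _) hC0)
        (norm_nonneg _) |>.trans (le_of_eq ?_)
      rw [Real.norm_of_nonneg (mul_nonneg hC0 hM0)]
    · rw [hη' _ ε hε.1 hε.2 hp, mul_zero, mul_zero, norm_zero]
      exact norm_nonneg _
  · refine ae_of_all _ fun p => ?_
    have hd : HasDerivAt (fun e => η (p.2 - e)) (-deriv η p.2) 0 := by
      have := (hdiff (p.2 - 0)).hasDerivAt.comp_const_sub p.2 0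
      rwa [sub_zero] at this
    have h1 := hd.tendsto_slope_zero_right
    have h2 : Tendsto (fun ε => (η (p.2 - ε) - η p.2) / ε) (𝓝[>] 0) (𝓝 (-deriv η p.2)) := by
      refine h1.congr fun ε => ?_
      rw [zero_add, sub_zero, smul_eq_mul, div_eq_inv_mul]
    have h3 := (h2.const_mul (φ p.1)).const_mul (f p)
    rwa [mul_neg, mul_neg] at h3

theorem tendsto_integral_diffQuot {f : X × ℝ → ℝ} (hf : IsLocL2 γ f) {φ : X → ℝ}
    {η : ℝ → ℝ} (hφ : IsCylindrical φ) (hη : IsTest η) :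
    Tendsto (fun δ : ℝ => ∫ p, diffQuot f δ p * (φ p.1 * η p.2) ∂(γ.prod volume))
      (𝓝[>] 0) (𝓝 (-∫ p, f p * (φ p.1 * deriv η p.2) ∂(γ.prod volume))) := by
  obtain ⟨a, b, ha, hab, h0⟩ := hη.exists_Icc
  obtain ⟨C, hC0, hC⟩ := hη.exists_bound
  have hηc := hη.1.continuous
  have hsq : Tendsto (fun δ : ℝ => δ ^ 2) (𝓝[>] 0) (𝓝[>] 0) := by
    refine tendsto_nhdsWithin_iff.2 ⟨?_, ?_⟩
    · have : Tendsto (fun δ : ℝ => δ ^ 2) (𝓝 0) (𝓝 (0 ^ 2)) := (continuous_pow 2).tendsto 0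
      rw [zero_pow two_ne_zero] at this
      exact this.mono_left nhdsWithin_le_nhds
    · filter_upwards [self_mem_nhdsWithin] with δ hδ
      exact pow_pos (mem_Ioi.1 hδ) 2
  refine ((hη.tendsto_integral_quotient hf hφ).comp hsq).congr' ?_
  -- For `δ < a` the cut-off lies below the support of `η`, so discrete integration by parts is
  -- exact.
  filter_upwards [Ioo_mem_nhdsGT ha] with δ hδ
  set ε := δ ^ 2
  have hε : 0 < ε := pow_pos hδ.1 2
  have hτ := measurePreserving_translate (γ := γ) ε
  have i2 : Integrable (fun p => f p * (φ p.1 * η p.2)) (γ.prod volume) :=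
    hf.integrable_mul_test hφ hηc ha hC h0
  have i1' : Integrable (fun p => f p * (φ p.1 * η (p.2 - ε))) (γ.prod volume) := by
    refine hf.integrable_mul_test (η := fun y => η (y - ε)) hφ (by fun_prop)
      (a := a + ε) (b := b + ε) (by linarith) (fun y => hC _) fun y hy => h0 _ fun hm => hy ?_
    exact ⟨by linarith [hm.1], by linarith [hm.2]⟩
  have i1 : Integrable (fun p => f (p.1, p.2 + ε) * (φ p.1 * η p.2)) (γ.prod volume) := by
    have := hτ.integrable_comp_of_integrable i1'
    simpa [Function.comp_def] using this
  have e1 : ∫ p, f (p.1, p.2 + ε) * (φ p.1 * η p.2) ∂(γ.prod volume) =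
      ∫ p, f p * (φ p.1 * η (p.2 - ε)) ∂(γ.prod volume) := by
    conv_rhs => rw [← hτ.map_eq, integral_map hτ.aemeasurable
      (by rw [hτ.map_eq]; exact i1'.aestronglyMeasurable)]
    simp
  have l1 : ∀ p : X × ℝ, f p * (φ p.1 * ((η (p.2 - ε) - η p.2) / ε)) =
      (f p * (φ p.1 * η (p.2 - ε)) - f p * (φ p.1 * η p.2)) * ε⁻¹ := fun p => by ring
  have l2 : ∀ p : X × ℝ, diffQuot f δ p * (φ p.1 * η p.2) =
      (f (p.1, p.2 + ε) * (φ p.1 * η p.2) - f p * (φ p.1 * η p.2)) * ε⁻¹ := by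
    intro p
    by_cases hp : δ ≤ p.2
    · rw [diffQuot, if_pos hp]
      ring
    · rw [h0 p.2 fun hm => hp (hδ.2.le.trans hm.1)]
      ring
  change ∫ p, f p * (φ p.1 * ((η (p.2 - ε) - η p.2) / ε)) ∂(γ.prod volume) = _
  simp_rw [l1, l2]
  rw [integral_mul_const, integral_mul_const, integral_sub i1' i2, integral_sub i1 i2, e1]

theorem memLp_rpow_mul_test (s : ℝ) {φ : X → ℝ} {η : ℝ → ℝ} (hφ : IsCylindrical φ)
    (hη : IsTest η) :
    MemLp (fun p : X × ℝ => p.2 ^ (-(1 - 2 * s)) * (φ p.1 * η p.2)) 2 (extMeasure γ s) := by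
  obtain ⟨a, b, ha, hab, h0⟩ := hη.exists_Icc
  obtain ⟨M, hM0, hM⟩ := hη.exists_bound
  obtain ⟨C, hC0, hC⟩ := hφ.exists_bound
  obtain ⟨A, hA0, hA⟩ := exists_rpow_le (1 - 2 * s) (b := b) ha
  obtain ⟨B, hB0, hB⟩ := exists_rpow_le (-(1 - 2 * s)) (b := b) ha
  have hφc := hφ.continuous.measurable
  have hηc := hη.1.continuous.measurable
  have hm : Measurable fun p : X × ℝ => p.2 ^ (-(1 - 2 * s)) * (φ p.1 * η p.2) := by fun_prop
  rw [memLp_two_iff hm.aestronglyMeasurable, lintegral_extMeasure s (by fun_prop)]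
  have hle : ∀ y ∈ Ioi (0 : ℝ), ENNReal.ofReal (y ^ (1 - 2 * s)) *
      ∫⁻ x, ‖y ^ (-(1 - 2 * s)) * (φ x * η y)‖ₑ ^ 2 ∂γ ≤
      (Icc a b).indicator (fun _ => ENNReal.ofReal A *
        (ENNReal.ofReal (B * (C * M)) ^ 2 * γ univ)) y := by
    intro y hy
    by_cases hyI : y ∈ Icc a b
    · rw [indicator_of_mem hyI, ← lintegral_const]
      gcongr with x
      · exact hA y hyI
      · rw [Real.enorm_eq_ofReal_abs]
        refine ENNReal.ofReal_le_ofReal ?_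
        rw [abs_mul, abs_mul, abs_of_nonneg (Real.rpow_nonneg (le_of_lt hy) _)]
        exact mul_le_mul (hB y hyI) (mul_le_mul (hC x) (hM y) (abs_nonneg _) hC0) (by positivity) hB0
    · simp [h0 y hyI]
  refine (setLIntegral_mono (measurable_const.indicator measurableSet_Icc) hle).trans_lt ?_
  refine (setLIntegral_le_lintegral _ _).trans_lt ?_
  rw [lintegral_indicator_const measurableSet_Icc, Real.volume_Icc]
  exact ENNReal.mul_lt_top (ENNReal.mul_lt_top ENNReal.ofReal_lt_top (ENNReal.mul_lt_top
    (ENNReal.pow_lt_top ENNReal.ofReal_lt_top) (measure_lt_top _ _))) ENNReal.ofReal_lt_top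

/-- A function whose vertical increments are controlled by `w` in the mean has a weak vertical
derivative of no more energy than `w`. -/
theorem exists_hasWeakDy_of_sub_sq_le {f w : X × ℝ → ℝ} (hf : Measurable f) (hfl : IsLocL2 γ f)
    (hw : Measurable w) {s : ℝ} (hs : s < 1) (hE : energy γ s w < ⊤)
    (h : ∀ ε, 0 < ε → ∀ᵐ y : ℝ, 0 < y → ∫⁻ x, ‖f (x, y + ε) - f (x, y)‖ₑ ^ 2 ∂γ ≤
      ENNReal.ofReal ε * ∫⁻ θ in Ioc 0 ε, ∫⁻ x, ‖w (x, y + θ)‖ₑ ^ 2 ∂γ) :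
    ∃ u, HasWeakDy γ f u ∧ energy γ s u ≤ energy γ s w := by
  set μ := extMeasure γ s with hμ
  have hb : ∀ δ, 0 < δ → energy γ s (diffQuot f δ) ≤ ENNReal.ofReal (1 + δ) * energy γ s w :=
    fun δ hδ => energy_diffQuot_le hf hw hs hδ (h _ (by positivity))
  have hmem : ∀ δ, 0 < δ → MemLp (diffQuot f δ) 2 μ := fun δ hδ =>
    (memLp_two_iff (measurable_diffQuot hf δ).aestronglyMeasurable).2
      ((hb δ hδ).trans_lt (ENNReal.mul_lt_top ENNReal.ofReal_lt_top hE))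
  -- The value at `δ ≤ 0` is irrelevant, since the limit is taken along `𝓝[>] 0`.
  let D : ℝ → Lp ℝ 2 μ := fun δ => if hδ : 0 < δ then (hmem δ hδ).toLp else 0
  let I := {q : (X → ℝ) × (ℝ → ℝ) // IsCylindrical q.1 ∧ IsTest q.2}
  let e : I → Lp ℝ 2 μ := fun i => (memLp_rpow_mul_test s i.2.1 i.2.2).toLp
  have hinner : ∀ (g : Lp ℝ 2 μ) (g' : X × ℝ → ℝ), g =ᵐ[μ] g' → ∀ i : I, inner ℝ g (e i) =
      ∫ p, g' p * (i.1.1 p.1 * i.1.2 p.2) ∂(γ.prod volume) := by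
    intro g g' hg i
    rw [← integral_extMeasure_mul s g' i.1.1 fun y hy => i.2.2.eq_zero_of_nonpos hy, L2.inner_def]
    refine integral_congr_ae ?_
    filter_upwards [hg, (memLp_rpow_mul_test s i.2.1 i.2.2).coeFn_toLp] with p h1 h2
    rw [h1, h2]
    simp [mul_comm]
  have hnorm : ∀ g : Lp ℝ 2 μ, ∀ g' : X × ℝ → ℝ, g =ᵐ[μ] g' →
      energy γ s g' = ENNReal.ofReal (‖g‖ ^ 2) := by
    intro g g' hg
    rw [energy, lintegral_enorm_sq_eq, ← hμ, ← eLpNorm_congr_ae hg,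
      ENNReal.ofReal_pow (norm_nonneg _), Lp.norm_def, ENNReal.ofReal_toReal (Lp.eLpNorm_ne_top g)]
  have hc : Tendsto (fun δ : ℝ => √(1 + δ)) (𝓝[>] 0) (𝓝 1) := by
    have : Tendsto (fun δ : ℝ => √(1 + δ)) (𝓝 0) (𝓝 (√(1 + 0))) :=
      (by fun_prop : Continuous fun δ : ℝ => √(1 + δ)).tendsto 0
    rw [add_zero, Real.sqrt_one] at this
    exact this.mono_left nhdsWithin_le_nhds
  have hle : ∀ᶠ δ in 𝓝[>] (0 : ℝ), 0 < √(1 + δ) ∧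
      ‖D δ‖ ≤ √(1 + δ) * √(energy γ s w).toReal := by
    filter_upwards [self_mem_nhdsWithin] with δ hδ
    have hδ : 0 < δ := hδ
    refine ⟨Real.sqrt_pos.2 (by linarith), ?_⟩
    have h1 := hb δ hδ
    have hD : D δ = (hmem δ hδ).toLp := dif_pos hδ
    rw [hnorm _ _ (hmem δ hδ).coeFn_toLp, ← hD, ← ENNReal.ofReal_toReal hE.ne,
      ← ENNReal.ofReal_mul (by linarith), ENNReal.ofReal_le_ofReal_iff (by positivity)] at h1
    rw [← Real.sqrt_mul (by linarith)]
    exact Real.le_sqrt_of_sq_le h1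
  have hlim : ∀ i : I, Tendsto (fun δ => inner ℝ (D δ) (e i)) (𝓝[>] 0)
      (𝓝 (-∫ p, f p * (i.1.1 p.1 * deriv i.1.2 p.2) ∂(γ.prod volume))) := by
    intro i
    refine (tendsto_integral_diffQuot hfl i.2.1 i.2.2).congr' ?_
    filter_upwards [self_mem_nhdsWithin] with δ hδ
    have hδ : 0 < δ := hδ
    have hD : D δ = (hmem δ hδ).toLp := dif_pos hδ
    rw [hD]
    exact (hinner _ _ (hmem δ hδ).coeFn_toLp i).symm
  obtain ⟨u, hu, hue⟩ := exists_inner_eq_of_tendsto hc hle hlim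
  have hum : Measurable u := (Lp.stronglyMeasurable u).measurable
  have huE : energy γ s u ≤ energy γ s w := by
    rw [hnorm u u (ae_eq_refl _), ← ENNReal.ofReal_toReal hE.ne]
    refine ENNReal.ofReal_le_ofReal ?_
    rw [← Real.sq_sqrt (ENNReal.toReal_nonneg (a := energy γ s w))]
    exact pow_le_pow_left₀ (norm_nonneg _) hu 2
  refine ⟨u, ⟨hfl, isLocL2_of_energy_lt_top hum (huE.trans_lt hE), fun φ η hφ hη => ?_⟩, huE⟩
  have := hue ⟨(φ, η), hφ, hη⟩
  rw [hinner u u (ae_eq_refl _)] at this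
  rw [this, neg_neg]

end Limit

/-! ### Application to the symmetrised function. -/

section Main

variable {X : Type*} [NormedAddCommGroup X] [NormedSpace ℝ X] [CompleteSpace X]
  [SecondCountableTopology X] [MeasurableSpace X] [BorelSpace X] {γ : Measure X} [IsGaussian γ]

theorem isLocL2_ehrhardExt (hc : ∀ L : StrongDual ℝ X, ∫ x, L x ∂γ = 0) {ℓ : StrongDual ℝ X}
    (h1 : ℓ (covOp γ ℓ) = 1) {v : X × ℝ → ℝ} (hv : Measurable v) (hvl : IsLocL2 γ v) :
    IsLocL2 γ (ehrhardExt γ ℓ v) := by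
  intro a b ha
  have hm := measurable_ehrhardExt γ ℓ hv
  have h := hvl a b ha
  rw [memLp_two_iff hv.aestronglyMeasurable, ← Measure.prod_restrict, Measure.restrict_univ,
    lintegral_prod_symm' _ (by fun_prop)] at h
  rw [memLp_two_iff hm.aestronglyMeasurable, ← Measure.prod_restrict, Measure.restrict_univ,
    lintegral_prod_symm' _ (by fun_prop)]
  refine (lintegral_mono fun y => ?_).trans_lt h
  exact lintegral_ehrhard_sq_le hc h1 (u := fun x => v (x, y)) (by fun_prop)

theorem HasWeakDy.exists_ehrhardExt (hc : ∀ L : StrongDual ℝ X, ∫ x, L x ∂γ = 0)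
    {ℓ : StrongDual ℝ X} (h1 : ℓ (covOp γ ℓ) = 1) {s : ℝ} (hs : s < 1) {v w : X × ℝ → ℝ}
    (hv : HasWeakDy γ v w) (hE : energy γ s w < ⊤) :
    ∃ u, HasWeakDy γ (ehrhardExt γ ℓ v) u ∧ energy γ s u ≤ energy γ s w := by
  -- The contraction estimate needs measurable slices, so the argument runs on Borel representatives
  -- and returns to `v` by `ehrhardExt_congr_ae`.
  obtain ⟨v', hv'm, hvv'⟩ := hv.locL2.exists_measurable
  obtain ⟨w', hw'm, hww'⟩ := hv.locL2_deriv.exists_measurable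
  have hv' : HasWeakDy γ v' w' := hv.congr hvv' hww'
  rw [energy_congr hww'] at hE ⊢
  obtain ⟨u, hu, huE⟩ := exists_hasWeakDy_of_sub_sq_le (measurable_ehrhardExt γ ℓ hv'm)
    (isLocL2_ehrhardExt hc h1 hv'm hv'.locL2) hw'm hs hE fun ε hε => by
      filter_upwards [hv'.ae_lintegral_sub_sq_le hw'm hε] with y hy hpos
      exact (lintegral_ehrhard_sub_sq_le hc h1 (u := fun x => v' (x, y + ε))
        (u' := fun x => v' (x, y)) (by fun_prop) (by fun_prop)).trans (hy hpos)
  refine ⟨u, hu.congr ?_ (ae_of_all _ fun _ _ => rfl), huE⟩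
  have hms : MeasurableSet ((univ : Set X) ×ˢ Ioi (0 : ℝ)) := MeasurableSet.univ.prod measurableSet_Ioi
  have hr : γ.prod ((volume : Measure ℝ).restrict (Ioi 0)) =
      (γ.prod volume).restrict (univ ×ˢ Ioi 0) := by
    rw [← Measure.prod_restrict, Measure.restrict_univ]
  have h2 : v' =ᵐ[γ.prod (volume.restrict (Ioi 0))] v := by
    rw [hr]
    filter_upwards [ae_restrict_of_ae hvv', ae_restrict_mem hms] with p hp hm
    exact (hp hm.2).symm
  have h3 := ehrhardExt_congr_ae hc h1 h2
  rw [hr] at h3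
  filter_upwards [(ae_restrict_iff' hms).1 h3] with p hp hpos
  exact hp ⟨mem_univ _, hpos⟩

end Main

end Wiener

end

theorem mainTheorem4 {X : Type*} [NormedAddCommGroup X] [NormedSpace ℝ X] [CompleteSpace X]
    [TopologicalSpace.SeparableSpace X] [MeasurableSpace X] [BorelSpace X]
    (γ : MeasureTheory.Measure X) [ProbabilityTheory.IsGaussian γ]
    (hcentred : ∀ L : StrongDual ℝ X, ∫ x, L x ∂γ = 0)
    (hnondeg : ∀ L : StrongDual ℝ X, L ≠ 0 → 0 < ∫ x, L x ^ 2 ∂γ)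
    (s : ℝ) (hs : s ∈ Set.Ioo (0 : ℝ) 1)
    (ℓ : StrongDual ℝ X) (hℓ : ‖Wiener.ofDual γ ℓ‖ = 1)
    (v : X × ℝ → ℝ) (hv : Wiener.MemH1 γ s v) :
    ∀ dv : X × ℝ → ℝ, Wiener.HasWeakDy γ v dv →
      ∃ dvStar : X × ℝ → ℝ, Wiener.HasWeakDy γ (Wiener.ehrhardExt γ ℓ v) dvStar ∧
        Wiener.energy γ s dvStar ≤ Wiener.energy γ s dv := by
  intro dv hdv
  have : SecondCountableTopology X := UniformSpace.secondCountable_of_separable X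
  have h1 := Wiener.dual_covOp_self hℓ
  -- No uniqueness of weak derivatives is invoked: if the given `dv` had infinite energy, the
  -- finite-energy derivative from `MemH1` would yield `dvStar`, and the inequality would be
  -- trivial.
  by_cases hE : Wiener.energy γ s dv < ⊤
  · exact hdv.exists_ehrhardExt hcentred h1 hs.2 hE
  · obtain ⟨w, G, hw, -, hfin⟩ := hv
    have hwE : Wiener.energy γ s w < ⊤ :=
      lt_of_le_of_lt (MeasureTheory.lintegral_mono fun p => le_add_self) hfin
    obtain ⟨u, hu, -⟩ := hw.exists_ehrhardExt hcentred h1 hs.2 hwE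
    exact ⟨u, hu, by rw [not_lt_top_iff.1 hE]; exact le_top⟩
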